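/- **Setting.** Let $d\ge 2$, let $\Omega\subseteq\mathbb R^d$ be a bounded Lipschitz domain (open, connected, locally on one side of the graph of a Lipschitz function), let $0<T<\infty$ and $I:=(0,T)$. Let $\{\mathcal T_h\}_{h\in\mathcal H}$, $\mathcal H\subseteq(0,\infty)$, be a family of uniformly shape regular, conforming triangulations of $\Omega$ into $d$-dimensional simplices, where $h$ is the maximal diameter of a simplex of $\mathcal T_h$. For fixed $m,\ell\in\mathbb N_0$ and each $h\in\mathcal H$ let $V_h\subseteq(\mathbb P^m_c(\mathcal T_h))^d$ and $Q_h\subseteq\mathbb P^\ell(\mathcal T_h)$ be linear subspaces, where $\mathbb P^\ell(\mathcal T_h)$ denotes the functions that are polynomials of degree at most $\ell$ on each simplex and $\mathbb P^m_c(\mathcal T_h)=\mathbb P^m(\mathcal T_h)\cap C^0(\overline\Omega)$. Assume that $\inf_{z_h\in Q_h}\|z-z_h\|_{L^s(\Omega)}\to0$ as $h\to0$ for all $s\in[1,\infty)$ and $z\in L^s(\Omega)$, and that there are linear projections $\Pi^Q_h\colon L^1(\Omega)\to Q_h$ such that for every $s\in(1,\infty)$ there is a constant $c$, independent of $h$,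 with $\|\Pi_h^Qz\|_{L^s(\Omega)}\le c\,\|z\|_{L^s(\Omega)}$ for all $z\in L^s(\Omega)$. Put $$\mathring V_{h,0}:=\{\mathbf z\in V_h\cap W^{1,1}_0(\Omega;\mathbb R^d)\mid (\operatorname{div}\mathbf z,q)_\Omega=0\ \text{for all } q\in Q_h\}.$$ Let $Y:=L^2(\Omega;\mathbb R^d)$, let $H$ be the closure in $Y$ of $\{\varphi\in C_c^\infty(\Omega;\mathbb R^d)\mid\operatorname{div}\varphi=0\}$, and let $P_{H^\perp}\colon Y\to H^\perp$ be the orthogonal projection onto the orthogonal complement $H^\perp$ of $H$ in $Y$. **Lemma.** Let $(h_n)_{n\in\mathbb N}\subseteq\mathcal H$ with $h_n\to0$, let $r\in(1,\infty)$, and let $(\tau_n)_{n\in\mathbb N}\subseteq(0,T)$ with $\tau_n\to0$. Let $v_n\in L^\infty(I;\mathring V_{h_n,0})$, $n\in\mathbb N$, satisfy $$\sup_{n\in\mathbb N}\big[\|v_n\|_{L^\infty(I;Y)}+\|\operatorname{div}v_n\|_{L^1((\tau_n,T);L^r(\Omega))}\big]<\infty.$$ Then there exist a subsequence $(v_{n_k})_{k\in\mathbb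 N}$ and a measurable set $I_\perp\subseteq I$ with $|I\setminus I_\perp|=0$ such that $$P_{H^\perp}(v_{n_k}(t))\rightharpoonup 0\quad\text{weakly in }H^\perp\text{ as }k\to\infty,\qquad\text{for all }t\in I_\perp.$$ -/

import Mathlib

open MeasureTheory Filter Topology Set
open scoped ENNReal NNReal ContDiff

noncomputable section

/-- The Euclidean space `ℝ^d`. -/
abbrev Euc (d : ℕ) : Type := EuclideanSpace ℝ (Fin d)

/-- The Lebesgue measure on `Ω ⊆ ℝ^d`. -/
abbrev leb {d : ℕ} (Ω : Set (Euc d)) : Measure (Euc d) := volume.restrict Ω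

/-- The Hilbert space `Y = L²(Ω; ℝ^d)`. -/
abbrev YSpace {d : ℕ} (Ω : Set (Euc d)) : Type := Lp (Euc d) 2 (leb Ω)

/-! ### Domains and triangulations -/

/-- A bounded Lipschitz domain: a nonempty, connected, bounded open set which, near each of its
boundary points and after a rotation, lies strictly on one side of the graph of a Lipschitz
function. Here `e` is the direction of the last coordinate axis, and the graph is taken over the
hyperplane orthogonal to `e`. -/
structure IsBoundedLipschitzDomain {d : ℕ} (Ω : Set (Euc d)) : Prop where
  isOpen : IsOpen Ω
  isConnected : IsConnected Ω
  isBounded : Bornology.IsBounded Ω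
  lipschitz_boundary : ∀ x ∈ frontier Ω, ∃ (e : Euc d) (γ : (ℝ ∙ e)ᗮ → ℝ) (K : ℝ≥0) (ρ : ℝ),
    ‖e‖ = 1 ∧ LipschitzWith K γ ∧ 0 < ρ ∧
      ∀ y ∈ Metric.ball x ρ, y ∈ Ω ↔ inner ℝ e y < γ ((ℝ ∙ e)ᗮ.orthogonalProjectionOnto y)

/-- The vertex sets of the `d`-dimensional simplices of a simplicial complex in `ℝ^d`. -/
def cells {d : ℕ} (K : Geometry.SimplicialComplex ℝ (Euc d)) : Set (Finset (Euc d)) :=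
  {s | s ∈ K.faces ∧ s.card = d + 1}

/-- `K` is a (conforming) triangulation of `Ω` by `d`-dimensional simplices, of maximal mesh-size
`h`, that is, `h` is the largest diameter of a cell. -/
structure IsTriangulation {d : ℕ} (Ω : Set (Euc d)) (h : ℝ)
    (K : Geometry.SimplicialComplex ℝ (Euc d)) : Prop where
  finite : K.faces.Finite
  space_eq : K.space = closure Ω
  pure : ∀ s ∈ K.faces, ∃ t ∈ cells K, s ⊆ t
  mesh : IsGreatest ((fun s : Finset (Euc d) => Metric.diam (convexHull ℝ (s : Set (Euc d)))) ''
    cells K) h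

/-- A uniformly shape regular family of triangulations of `Ω`, indexed by the mesh-sizes
`h ∈ H`: the ratio of the diameter of a cell to the radius of some ball inside this cell is
bounded uniformly over all cells of all triangulations. -/
structure IsShapeRegularFamily {d : ℕ} (Ω : Set (Euc d)) (H : Set ℝ)
    (𝒯 : ℝ → Geometry.SimplicialComplex ℝ (Euc d)) : Prop where
  triangulation : ∀ h ∈ H, IsTriangulation Ω h (𝒯 h)
  shape_regular : ∃ κ : ℝ, ∀ h ∈ H, ∀ s ∈ cells (𝒯 h), ∃ (x : Euc d) (ρ : ℝ), 0 < ρ ∧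
    Metric.ball x ρ ⊆ convexHull ℝ (s : Set (Euc d)) ∧
    Metric.diam (convexHull ℝ (s : Set (Euc d))) ≤ κ * ρ

/-! ### Piecewise polynomial functions -/

/-- `f ∈ ℙ^m(K)`: on each simplex, `f` agrees almost everywhere with a polynomial of (total)
degree at most `m`. -/
def IsPiecewisePoly {d : ℕ} (Ω : Set (Euc d)) (K : Geometry.SimplicialComplex ℝ (Euc d)) (m : ℕ)
    (f : Euc d → ℝ) : Prop :=
  ∀ s ∈ cells K, ∃ p : MvPolynomial (Fin d) ℝ, p.totalDegree ≤ m ∧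
    ∀ᵐ x ∂(leb Ω), x ∈ convexHull ℝ (s : Set (Euc d)) → f x = MvPolynomial.eval (fun j => x j) p

/-- `f ∈ ℙ^m_c(K) = ℙ^m(K) ∩ C⁰(closure Ω)`. -/
def IsContPiecewisePoly {d : ℕ} (Ω : Set (Euc d)) (K : Geometry.SimplicialComplex ℝ (Euc d))
    (m : ℕ) (f : Euc d → ℝ) : Prop :=
  IsPiecewisePoly Ω K m f ∧ ∃ g : Euc d → ℝ, ContinuousOn g (closure Ω) ∧ f =ᵐ[leb Ω] g

/-! ### Weak derivatives, divergence, and `W^{1,1}_0` -/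

/-- `φ ∈ C_c^∞(Ω; F)`. -/
def IsTestFunction {d : ℕ} {F : Type*} [NormedAddCommGroup F] [NormedSpace ℝ F]
    (Ω : Set (Euc d)) (φ : Euc d → F) : Prop :=
  ContDiff ℝ ∞ φ ∧ HasCompactSupport φ ∧ tsupport φ ⊆ Ω

/-- `G` is the weak derivative (Jacobian) of `f` in `Ω`, both being locally integrable in `Ω`. -/
def HasWeakDeriv {d : ℕ} (Ω : Set (Euc d)) (f : Euc d → Euc d)
    (G : Euc d → Euc d →L[ℝ] Euc d) : Prop :=
  LocallyIntegrableOn f Ω ∧ LocallyIntegrableOn G Ω ∧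
    ∀ φ : Euc d → ℝ, IsTestFunction Ω φ → ∀ w : Euc d,
      ∫ x in Ω, (fderiv ℝ φ x w) • f x = - ∫ x in Ω, φ x • G x w

open Classical in
/-- The weak derivative of `f` in `Ω`, unique up to null sets (zero if there is none). -/
def weakDeriv {d : ℕ} (Ω : Set (Euc d)) (f : Euc d → Euc d) : Euc d → Euc d →L[ℝ] Euc d :=
  if h : ∃ G, HasWeakDeriv Ω f G then h.choose else 0

/-- The trace `∑ᵢ Aᵢᵢ` of a Jacobian matrix. -/
def jacTrace {d : ℕ} (A : Euc d →L[ℝ] Euc d) : ℝ :=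
  ∑ i : Fin d, A (EuclideanSpace.single i 1) i

/-- The divergence of a weakly differentiable vector field. -/
def weakDiv {d : ℕ} (Ω : Set (Euc d)) (f : Euc d → Euc d) : Euc d → ℝ :=
  fun x => jacTrace (weakDeriv Ω f x)

/-- `f ∈ W^{1,1}_0(Ω; ℝ^d)`, the closure of `C_c^∞(Ω; ℝ^d)` in `W^{1,1}(Ω; ℝ^d)`. -/
def MemW110 {d : ℕ} (Ω : Set (Euc d)) (f : Euc d → Euc d) : Prop :=
  MemLp f 1 (leb Ω) ∧ ∃ G : Euc d → Euc d →L[ℝ] Euc d, MemLp G 1 (leb Ω) ∧ HasWeakDeriv Ω f G ∧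
    ∃ φ : ℕ → Euc d → Euc d, (∀ n, IsTestFunction Ω (φ n)) ∧
      Tendsto (fun n => eLpNorm (fun x => f x - φ n x) 1 (leb Ω)) atTop (𝓝 0) ∧
      Tendsto (fun n => eLpNorm (fun x => G x - fderiv ℝ (φ n) x) 1 (leb Ω)) atTop (𝓝 0)

/-! ### The space `H` -/

/-- The elements of `Y` given by divergence-free fields in `C_c^∞(Ω; ℝ^d)`. -/
def divFreeTest {d : ℕ} (Ω : Set (Euc d)) : Set (YSpace Ω) :=
  {u | ∃ φ : Euc d → Euc d, IsTestFunction Ω φ ∧ (∀ x, jacTrace (fderiv ℝ φ x) = 0) ∧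
    u =ᵐ[leb Ω] φ}

/-- The space `H`: the closure in `Y` of the smooth, compactly supported, divergence-free fields.
(These already form a linear subspace, so taking the span adds nothing.) -/
def HSol {d : ℕ} (Ω : Set (Euc d)) : Submodule ℝ (YSpace Ω) :=
  (Submodule.span ℝ (divFreeTest Ω)).topologicalClosure

/-! ### Finite element spaces -/

/-- The assumption on the scalar finite element spaces `Q_h`, `h ∈ H`: they are asymptotically
dense in `L^s(Ω)`, `s ∈ [1,∞)`, and there are linear projections `L¹(Ω) → Q_h` that are
`L^s`-stable for each `s ∈ (1,∞)`, with a constant independent of `h`. -/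
structure IsPressureFamily {d : ℕ} (Ω : Set (Euc d)) (H : Set ℝ)
    (Q : ℝ → Submodule ℝ (Lp ℝ 1 (leb Ω))) : Prop where
  approx : ∀ s : ℝ≥0∞, 1 ≤ s → s < ⊤ → ∀ z : Euc d → ℝ, MemLp z s (leb Ω) →
    Tendsto (fun h => ⨅ q ∈ Q h, eLpNorm (fun x => z x - q x) s (leb Ω)) (𝓝[H] 0) (𝓝 0)
  projection : ∃ P : (h : ℝ) → Lp ℝ 1 (leb Ω) →ₗ[ℝ] Q h,
    (∀ h ∈ H, ∀ q : Q h, P h q = q) ∧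
    ∀ s : ℝ≥0∞, 1 < s → s < ⊤ → ∃ c : ℝ≥0, ∀ h ∈ H, ∀ z : Lp ℝ 1 (leb Ω),
      MemLp z s (leb Ω) → eLpNorm (P h z : Lp ℝ 1 (leb Ω)) s (leb Ω) ≤ c * eLpNorm z s (leb Ω)

/-- The discretely divergence-free fields: the `z ∈ V ∩ W^{1,1}_0(Ω; ℝ^d)` such that
`(div z, q)_Ω = 0` for all `q ∈ Q`. -/
def discDivFree {d : ℕ} (Ω : Set (Euc d)) (V : Submodule ℝ (YSpace Ω))
    (Q : Submodule ℝ (Lp ℝ 1 (leb Ω))) : Set (YSpace Ω) :=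
  {z | z ∈ V ∧ MemW110 Ω z ∧ ∀ q ∈ Q, ∫ x in Ω, weakDiv Ω z x * q x = 0}

end

/-! Tested with a gradient, `v n t` is small. For `q` of class C¹ on the whole space, integration by
parts in W^{1,1}_0 and the discrete constraint give ∫ ∇q·v_n = -∫ div v_n (q - q_h) for every q_h in
the pressure space. Hölder's inequality bounds this by ‖div v_n‖_r ‖q - q_h‖_s with s < ∞ conjugate
to r. Choosing q_h close to q, the pairings tend to zero in L¹ in time over (τ_n, T)
(`enorm_integral_fderiv_le_of_mem_discDivFree`). Since Y is separable and the v_n are bounded in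
L^∞(I; Y), a diagonal subsequence then converges for almost every t against all elements of the
closed span of gradients, with one null set for all of them (`exists_subseq_ae_tendsto_inner_zero`).

It remains to see that this closed span contains H^⊥, equivalently that a field v orthogonal to all
gradients lies in H (`mem_HSol_of_forall_integral_fderiv_eq_zero`). As q need not vanish on the
boundary, the orthogonality encodes both div v = 0 and a zero normal trace. The vector measure v dx
is pushed into Ω by Φ = id + tX, with X pointing inwards, and then mollified. The result is smooth,
compactly supported in Ω and divergence-free, because its divergence at y is a pairing of v with the
gradient of x ↦ ρ(y - Φ x). As t → 0 these fields stay bounded in L² and converge weakly to v, which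
suffices because H is its own double orthogonal complement. -/

/-! ### Lipschitz domains: cones and an inward vector field -/

/-- Uniform cone property of a Lipschitz domain near a boundary point. -/
theorem IsBoundedLipschitzDomain.exists_cone {d : ℕ} {Ω : Set (Euc d)}
    (hΩ : IsBoundedLipschitzDomain Ω) (x : Euc d) (hx : x ∈ frontier Ω) :
    ∃ (e : Euc d) (c R : ℝ), ‖e‖ = 1 ∧ 0 < c ∧ 0 < R ∧
      ∀ y ∈ Ω, y ∈ Metric.ball x R → ∀ s : ℝ, ∀ b : Euc d, ‖b‖ ≤ c * s →
        y - s • e + b ∈ Metric.ball x R → y - s • e + b ∈ Ω := by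
  obtain ⟨e, γ, K, ρ, he, hγ, hρ, hgraph⟩ := hΩ.lipschitz_boundary x hx
  have hK : (0 : ℝ) < 1 + K := by positivity
  -- Moving by `-s • e` lowers the height by `s`. Adding `b` raises it by at most `‖b‖` and lowers
  -- the graph by at most `K * ‖b‖`, so `(1 + K) * ‖b‖ ≤ s` keeps the point below the graph.
  refine ⟨e, 1 / (1 + K), ρ, he, by positivity, hρ, fun y hy hyb s b hb hzb => ?_⟩
  rw [hgraph _ hzb]
  have h1 := (hgraph y hyb).1 hy
  set P := (ℝ ∙ e)ᗮ.orthogonalProjectionOnto with hP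
  have hPe : P e = 0 :=
    Submodule.orthogonalProjectionOnto_orthogonalComplement_singleton_eq_zero e
  have hPz : P (y - s • e + b) = P y + P b := by
    rw [map_add, map_sub, map_smul, hPe]; simp
  have hPb : ‖P b‖ ≤ ‖b‖ := Submodule.norm_orthogonalProjectionOnto_apply_le _ b
  have h2 : |γ (P y) - γ (P y + P b)| ≤ K * ‖P b‖ := by
    have := hγ.dist_le_mul (P y) (P y + P b)
    rwa [Real.dist_eq, dist_eq_norm, sub_add_cancel_left, norm_neg] at this
  have h3 : inner ℝ e b ≤ ‖b‖ := by
    simpa [he] using real_inner_le_norm e b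
  have h4 : (1 + K) * ‖b‖ ≤ s := by
    have := mul_le_mul_of_nonneg_left hb hK.le
    rwa [← mul_assoc, mul_one_div_cancel hK.ne', one_mul] at this
  have h5 : (K : ℝ) * ‖P b‖ ≤ K * ‖b‖ := by gcongr
  rw [hPz, inner_add_right, inner_sub_right, inner_smul_right, real_inner_self_eq_norm_sq, he]
  have := (abs_le.1 h2).2
  nlinarith

/-- A finite family of positive reals has a positive lower bound. -/
theorem Finset.exists_pos_forall_le {ι : Type*} (F : Finset ι) (f : ι → ℝ)
    (hf : ∀ i ∈ F, 0 < f i) : ∃ δ > 0, ∀ i ∈ F, δ ≤ f i := by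
  have h : ∀ᶠ δ : ℝ in 𝓝[>] 0, ∀ i ∈ F, δ ≤ f i := by
    rw [Filter.eventually_all_finset]
    intro i hi
    filter_upwards [Ioo_mem_nhdsGT (hf i hi)] with δ hδ using hδ.2.le
  obtain ⟨δ, h1, h2⟩ := (h.and self_mem_nhdsWithin).exists
  exact ⟨δ, h2, h1⟩

/-- A bounded Lipschitz domain admits a smooth compactly supported vector field pointing strictly
inwards along its boundary. -/
theorem IsBoundedLipschitzDomain.exists_inward_field {d : ℕ} {Ω : Set (Euc d)}
    (hΩ : IsBoundedLipschitzDomain Ω) :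
    ∃ X : Euc d → Euc d, ContDiff ℝ ∞ X ∧ HasCompactSupport X ∧
      ∃ c > 0, ∃ t₀ > 0, ∀ t, 0 < t → t ≤ t₀ → ∀ x ∈ Ω,
        Metric.ball (x + t • X x) (c * t) ⊆ Ω := by
  classical
  have hcl : IsCompact (closure Ω) := hΩ.isBounded.isCompact_closure
  have hfr : IsCompact (frontier Ω) := hcl.of_isClosed_subset isClosed_frontier
    frontier_subset_closure
  choose! e c R he hc hR hcone using hΩ.exists_cone
  obtain ⟨F, hcov⟩ := hfr.elim_nhds_subcover' (fun x _ => Metric.ball x (R x / 4))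
    (fun x hx => Metric.ball_mem_nhds x (by have := hR x hx; positivity))
  let η : (i : frontier Ω) → ContDiffBump (i : Euc d) := fun i =>
    ⟨R i / 4, R i / 2, by have := hR i i.2; positivity, by have := hR i i.2; linarith⟩
  obtain ⟨c₀, hc₀, hcle⟩ := F.exists_pos_forall_le (fun i => c i) (fun i _ => hc i i.2)
  obtain ⟨δ, hδ, hδle⟩ := F.exists_pos_forall_le (fun i => R i) (fun i _ => hR i i.2)
  -- `U` is a collar of the boundary on which some bump equals one. What remains of the closure is a
  -- compact subset of Ω.
  let U : Set (Euc d) := ⋃ i ∈ F, Metric.ball (i : Euc d) (R i / 4)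
  have hU : IsOpen U := isOpen_biUnion fun i _ => Metric.isOpen_ball
  have hKΩ : closure Ω \ U ⊆ Ω := by
    rintro x ⟨hx, hxU⟩
    by_contra hxΩ
    refine hxU (hcov ?_)
    rw [frontier, hΩ.isOpen.interior_eq]
    exact ⟨hx, hxΩ⟩
  obtain ⟨δ', hδ', hthick⟩ := (hcl.diff hU).exists_thickening_subset_open hΩ.isOpen hKΩ
  have hnorm : ∀ (S : Finset (frontier Ω)) (x : Euc d),
      ‖∑ i ∈ S, η i x • (-e i)‖ ≤ S.card := by
    intro S x
    refine (norm_sum_le_of_le S (n := fun _ => (1 : ℝ)) fun i _ => ?_).trans (by simp)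
    rw [norm_smul, norm_neg, he i i.2, mul_one, Real.norm_of_nonneg (η i).nonneg]
    exact (η i).le_one
  -- The field has norm at most `F.card`, and the ball to be included has radius `c₀ * t`; hence `t
  -- * N` exceeds every displacement below.
  set N : ℝ := F.card + c₀ + 1 with hN
  have hNpos : 0 < N := by positivity
  refine ⟨fun x => ∑ i ∈ F, η i x • (-e i), ?_, ?_, c₀, hc₀, min (δ / 4) δ' / N / 2,
    by positivity, ?_⟩
  · exact ContDiff.sum fun i _ => (η i).contDiff.smul contDiff_const
  · have : ∀ S : Finset (frontier Ω),
        HasCompactSupport (fun x : Euc d => ∑ i ∈ S, η i x • (-e i)) := by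
      intro S
      induction S using Finset.induction_on with
      | empty =>
        simp_rw [Finset.sum_empty]
        exact (HasCompactSupport.zero : HasCompactSupport (0 : Euc d → Euc d))
      | insert i S hi ih =>
        simp_rw [Finset.sum_insert hi]
        exact ((η i).hasCompactSupport.smul_right (f' := fun _ => -e i)).add ih
    exact this F
  · intro t ht htle x hx y hy
    have htN : t * N < min (δ / 4) δ' := by
      have : t * N ≤ min (δ / 4) δ' / 2 := by
        rw [div_right_comm, le_div_iff₀ hNpos] at htle
        exact htle
      have : 0 < min (δ / 4) δ' := by positivity
      linarith
    have htδ : t * N < δ / 4 := htN.trans_le (min_le_left _ _)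
    have htδ' : t * N < δ' := htN.trans_le (min_le_right _ _)
    obtain ⟨b, rfl⟩ : ∃ b, y = x + t • (∑ i ∈ F, η i x • (-e i)) + b :=
      ⟨_, (add_sub_cancel _ y).symm⟩
    have hb : ‖b‖ < c₀ * t := by simpa using hy
    have hsmall : ∀ S ⊆ F, t * ‖∑ i ∈ S, η i x • (-e i)‖ ≤ t * F.card := fun S hS => by
      have : (S.card : ℝ) ≤ F.card := by exact_mod_cast Finset.card_le_card hS
      exact mul_le_mul_of_nonneg_left ((hnorm S x).trans this) ht.le
    by_cases hxU : x ∈ U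
    -- The displacement is split into successive moves along the `-e i`, with weights frozen at the
    -- starting point `x`. Only an `i` with `x` in its half ball contributes, and short moves stay
    -- inside the full ball, where the cone at `i` (with `b = 0`) applies.
    · have hmove : ∀ S ⊆ F, x + t • (∑ i ∈ S, η i x • (-e i)) ∈ Ω := by
        intro S
        induction S using Finset.induction_on with
        | empty => intro _; simpa using hx
        | insert i S hi ih =>
          intro hS
          have hSF : S ⊆ F := fun j hj => hS (Finset.mem_insert_of_mem hj)
          have hiF : i ∈ F := hS (Finset.mem_insert_self i S)
          have h1 := ih hSF
          by_cases hη : η i x = 0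
          · rw [Finset.sum_insert hi, hη, zero_smul, zero_add]; exact h1
          have hxi : x ∈ Metric.ball (i : Euc d) (R i / 2) := by
            have : x ∈ Function.support (η i) := hη
            rwa [(η i).support_eq] at this
          have hRi := hδle i hiF
          have key : ∀ S' ⊆ F, x + t • (∑ i ∈ S', η i x • (-e i)) ∈
              Metric.ball (i : Euc d) (R i) := by
            intro S' hS'
            rw [Metric.mem_ball, dist_eq_norm] at hxi ⊢
            rw [add_sub_right_comm]
            refine (norm_add_le _ _).trans_lt ?_
            rw [norm_smul, Real.norm_of_nonneg ht.le]
            have := hsmall S' hS'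
            nlinarith
          have heq : x + t • (∑ i ∈ insert i S, η i x • (-e i)) =
              x + t • (∑ i ∈ S, η i x • (-e i)) - (t * η i x) • e i + 0 := by
            rw [Finset.sum_insert hi, smul_add, smul_smul, smul_neg]; abel
          rw [heq]
          refine hcone i i.2 _ h1 (key S hSF) _ 0 ?_ ?_
          · rw [norm_zero]
            have := hc i i.2
            have := (η i).nonneg (x := x)
            positivity
          · rw [← heq]; exact key _ hS
      obtain ⟨j, hjF, hxj⟩ : ∃ j ∈ F, x ∈ Metric.ball (j : Euc d) (R j / 4) := by
        simpa [U] using hxU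
      have hηj : η j x = 1 := (η j).one_of_mem_closedBall (Metric.ball_subset_closedBall hxj)
      have hRj := hδle j hjF
      rw [Metric.mem_ball, dist_eq_norm] at hxj
      -- The move along an index `j` of weight one is kept for last: its full length `t` leaves room
      -- for every `b` with `‖b‖ ≤ c j * t`.
      have heq : x + t • (∑ i ∈ F, η i x • (-e i)) + b =
          x + t • (∑ i ∈ F.erase j, η i x • (-e i)) - t • e j + b := by
        rw [← Finset.add_sum_erase F _ hjF, hηj, one_smul, smul_add, smul_neg]; abel
      have hb' : ‖b‖ ≤ c j * t :=
        hb.le.trans (mul_le_mul_of_nonneg_right (hcle j hjF) ht.le)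
      have hsub := Finset.erase_subset j F
      have hball : ∀ S ⊆ F, ∀ b' : Euc d, ‖b'‖ ≤ c₀ * t →
          x + t • (∑ i ∈ S, η i x • (-e i)) + b' ∈ Metric.ball (j : Euc d) (R j) := by
        intro S hS b' hb'
        rw [Metric.mem_ball, dist_eq_norm, add_sub_right_comm, add_sub_right_comm]
        refine (norm_add₃_le).trans_lt ?_
        rw [norm_smul, Real.norm_of_nonneg ht.le]
        have := hsmall S hS
        nlinarith
      rw [heq]
      refine hcone j j.2 _ (hmove _ hsub) ?_ t b hb' ?_
      · simpa using hball _ hsub 0 (by simp; positivity)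
      · rw [← heq]; exact hball F subset_rfl b hb.le
    · refine hthick (Metric.mem_thickening_iff.2 ⟨x, ⟨subset_closure hx, hxU⟩, ?_⟩)
      rw [dist_eq_norm, add_assoc, add_sub_cancel_left]
      refine (norm_add_le _ _).trans_lt ?_
      rw [norm_smul, Real.norm_of_nonneg ht.le]
      have := hsmall F subset_rfl
      nlinarith

/-! ### Mollified push-forward of a vector field -/

/-- The trace of a Jacobian as a continuous linear functional. -/
noncomputable def jacTraceCLM (d : ℕ) : (Euc d →L[ℝ] Euc d) →L[ℝ] ℝ :=
  ∑ i : Fin d, (EuclideanSpace.proj i : Euc d →L[ℝ] ℝ) ∘L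
    ContinuousLinearMap.apply ℝ (Euc d) (EuclideanSpace.single i (1 : ℝ))

theorem jacTraceCLM_apply {d : ℕ} (A : Euc d →L[ℝ] Euc d) : jacTraceCLM d A = jacTrace A := by
  simp [jacTraceCLM, jacTrace]

theorem jacTrace_smulRight {d : ℕ} (f : Euc d →L[ℝ] ℝ) (w : Euc d) :
    jacTrace (f.smulRight w) = f w := by
  conv_rhs => rw [← (EuclideanSpace.basisFun (Fin d) ℝ).sum_repr w]
  simp [jacTrace, mul_comm]

/-- The mollification of the push-forward of the field `g` on `Ω` under `Φ`. -/
noncomputable def pushSmooth {d : ℕ} (ρ : ContDiffBump (0 : Euc d)) (Φ : Euc d → Euc d)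
    (Ω : Set (Euc d)) (g : Euc d → Euc d) (y : Euc d) : Euc d :=
  ∫ x in Ω, ρ.normed volume (y - Φ x) • g x

section PushSmooth

variable {d : ℕ} {ρ : ContDiffBump (0 : Euc d)} {Φ : Euc d → Euc d} {Ω : Set (Euc d)}
  {g : Euc d → Euc d}

theorem ContDiffBump.exists_normed_le (ρ : ContDiffBump (0 : Euc d)) :
    ∃ B, 0 ≤ B ∧ ∀ x, ρ.normed volume x ≤ B :=
  ⟨1 / volume.real (Metric.closedBall (0 : Euc d) ρ.rIn), by positivity,
    fun x => ρ.normed_le_div_measure_closedBall_rIn volume x⟩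

theorem ContDiffBump.normed_eq_zero_of_le (ρ : ContDiffBump (0 : Euc d)) {x : Euc d}
    (hx : ρ.rOut ≤ ‖x‖) : ρ.normed volume x = 0 := by
  rw [← Function.notMem_support, ρ.support_normed_eq]
  simpa using hx

theorem contDiff_pushSmooth (hΦ : ContDiff ℝ ∞ Φ) (hΩ : Bornology.IsBounded Ω)
    (hΩm : MeasurableSet Ω) (hg : IntegrableOn g Ω) :
    ContDiff ℝ ∞ (pushSmooth ρ Φ Ω g) := by
  obtain ⟨R, hR0, hR⟩ := hΩ.exists_pos_norm_le
  let χ : ContDiffBump (0 : Euc d) := ⟨R, R + 1, hR0, by linarith⟩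
  -- The integral is a convolution with a kernel depending on the parameter `p = y`, evaluated at
  -- the point 0. The cut-off `χ` makes the kernel compactly supported in `s` and equals one
  -- wherever `-s` lies in Ω.
  let k : Euc d → Euc d → ℝ := fun p s => χ s * ρ.normed volume (p - Φ (-s))
  have hk : ContDiff ℝ ∞ (fun q : Euc d × Euc d => k q.1 q.2) := by
    refine (χ.contDiff.comp contDiff_snd).mul (ρ.contDiff_normed.comp ?_)
    exact contDiff_fst.sub (hΦ.comp contDiff_snd.neg)
  have h := contDiffOn_convolution_right_with_param_comp (μ := volume) (n := ⊤)
    ((ContinuousLinearMap.lsmul ℝ ℝ).flip : Euc d →L[ℝ] ℝ →L[ℝ] Euc d)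
    (s := univ) (v := fun _ : Euc d => (0 : Euc d)) contDiffOn_const (f := Ω.indicator g)
    (g := k) (k := Metric.closedBall 0 (R + 1)) isOpen_univ (isCompact_closedBall _ _) ?_
    ((integrable_indicator_iff hΩm).2 hg).locallyIntegrable hk.contDiffOn
  · rw [contDiffOn_univ] at h
    convert h using 2 with y
    rw [pushSmooth, ← integral_indicator hΩm]
    simp only [MeasureTheory.convolution, ContinuousLinearMap.flip_apply,
      ContinuousLinearMap.lsmul_apply, zero_sub, k, neg_neg]
    congr 1 with x : 1
    by_cases hx : x ∈ Ω
    · have : χ (-x) = 1 := χ.one_of_mem_closedBall (by simpa using hR x hx)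
      rw [indicator_of_mem hx, indicator_of_mem hx, this, one_mul]
    · simp [hx]
  · intro p s _ hs
    have : χ s = 0 := χ.zero_of_le_dist (by
      have : R + 1 < dist s 0 := by simpa using hs
      exact this.le)
    simp [k, this]

theorem exists_of_pushSmooth_ne_zero {y : Euc d} (hy : pushSmooth ρ Φ Ω g y ≠ 0) :
    ∃ x ∈ Ω, ‖y - Φ x‖ < ρ.rOut := by
  by_contra! hcon
  refine hy (setIntegral_eq_zero_of_forall_eq_zero fun x hx => ?_)
  rw [ρ.normed_eq_zero_of_le (hcon x hx), zero_smul]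

/-- Nonzero values occur only within distance `ρ.rOut` of Φ(Ω). The factor 2 in `hball` leaves room
for the closure of the support. -/
theorem isTestFunction_pushSmooth (hΦ : ContDiff ℝ ∞ Φ) (hΩ : Bornology.IsBounded Ω)
    (hΩm : MeasurableSet Ω) (hg : IntegrableOn g Ω)
    (hball : ∀ x ∈ Ω, Metric.ball (Φ x) (2 * ρ.rOut) ⊆ Ω) :
    IsTestFunction Ω (pushSmooth ρ Φ Ω g) := by
  have hsub : tsupport (pushSmooth ρ Φ Ω g) ⊆ Ω := by
    intro y hy
    obtain ⟨y', hy', hd⟩ := Metric.mem_closure_iff.1 hy ρ.rOut ρ.rOut_pos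
    obtain ⟨x, hx, hxy⟩ := exists_of_pushSmooth_ne_zero hy'
    refine hball x hx ?_
    rw [← dist_eq_norm] at hxy
    rw [Metric.mem_ball]
    linarith [dist_triangle y y' (Φ x)]
  exact ⟨contDiff_pushSmooth hΦ hΩ hΩm hg,
    Metric.isCompact_of_isClosed_isBounded (isClosed_tsupport _) (hΩ.subset hsub), hsub⟩

theorem integrable_normed_smul {F : Type*} [NormedAddCommGroup F] [NormedSpace ℝ F]
    (hΦ : Continuous Φ) {f : Euc d → F} {μ : Measure (Euc d)} (hf : Integrable f μ) (y : Euc d) :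
    Integrable (fun x => ρ.normed volume (y - Φ x) • f x) μ := by
  obtain ⟨B, hB0, hB⟩ := ρ.exists_normed_le
  refine hf.bdd_smul (C := B) ?_ ?_
  · exact (ρ.continuous_normed.comp (continuous_const.sub hΦ)).aestronglyMeasurable
  · exact ae_of_all _ fun x => by
      rw [Real.norm_of_nonneg (ρ.nonneg_normed _)]; exact hB _

theorem hasFDerivAt_pushSmooth (hΦ : Continuous Φ) (hg : IntegrableOn g Ω) (y : Euc d) :
    Integrable (fun x => (fderiv ℝ (ρ.normed volume) (y - Φ x)).smulRight (g x)) (leb Ω) ∧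
    HasFDerivAt (pushSmooth ρ Φ Ω g)
      (∫ x in Ω, (fderiv ℝ (ρ.normed volume) (y - Φ x)).smulRight (g x)) y := by
  have hsm : ContDiff ℝ ∞ (ρ.normed volume) := ρ.contDiff_normed
  have hD : Continuous (fderiv ℝ (ρ.normed volume)) := hsm.continuous_fderiv (by simp)
  obtain ⟨B, hB⟩ := hD.bounded_above_of_compact_support
    (ρ.hasCompactSupport_normed.fderiv (𝕜 := ℝ))
  have hmeas : ∀ y, AEStronglyMeasurable
      (fun x => (fderiv ℝ (ρ.normed volume) (y - Φ x)).smulRight (g x)) (leb Ω) := fun y =>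
    (ContinuousLinearMap.smulRightL ℝ (Euc d) (Euc d)).aestronglyMeasurable_comp₂
      (hD.comp (continuous_const.sub hΦ)).aestronglyMeasurable hg.aestronglyMeasurable
  have hbound : ∀ y x, ‖(fderiv ℝ (ρ.normed volume) (y - Φ x)).smulRight (g x)‖ ≤ B * ‖g x‖ := by
    intro y x
    rw [ContinuousLinearMap.norm_smulRight_apply]
    gcongr
    exact hB _
  refine ⟨(hg.norm.const_mul B).mono' (hmeas y) (ae_of_all _ (hbound y)), ?_⟩
  refine hasFDerivAt_integral_of_dominated_of_fderiv_le (s := univ) (μ := leb Ω)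
    (bound := fun x => B * ‖g x‖)
    (F' := fun y x => (fderiv ℝ (ρ.normed volume) (y - Φ x)).smulRight (g x))
    (F := fun y x => ρ.normed volume (y - Φ x) • g x)
    univ_mem (Eventually.of_forall fun z => ?_) ?_ (hmeas y) ?_ (hg.norm.const_mul B) ?_
  · exact (integrable_normed_smul hΦ hg z).aestronglyMeasurable
  · exact integrable_normed_smul hΦ hg y
  · exact ae_of_all _ fun x z _ => hbound z x
  · refine ae_of_all _ fun x z _ => ?_
    have h1 : HasFDerivAt (ρ.normed volume) (fderiv ℝ (ρ.normed volume) (z - Φ x)) (z - Φ x) :=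
      (hsm.differentiable (by simp) _).hasFDerivAt
    have h2 : HasFDerivAt (fun z => z - Φ x) (ContinuousLinearMap.id ℝ (Euc d)) z :=
      (hasFDerivAt_id z).sub_const _
    exact (h1.comp z h2).smul_const (g x)

/-- By the chain rule, the factor `fderiv ℝ Φ x` turns the gradient of the kernel at `y - Φ x` into
minus the gradient in `x` of the composed kernel. The divergence thus becomes a pairing of `v` with
a gradient. -/
theorem jacTrace_fderiv_pushSmooth (hΦ : ContDiff ℝ ∞ Φ) {v : Euc d → Euc d}
    (hv : IntegrableOn (fun x => fderiv ℝ Φ x (v x)) Ω) (y : Euc d) :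
    jacTrace (fderiv ℝ (pushSmooth ρ Φ Ω (fun x => fderiv ℝ Φ x (v x))) y) =
      -∫ x in Ω, fderiv ℝ (fun x => ρ.normed volume (y - Φ x)) x (v x) := by
  obtain ⟨h1, h2⟩ := hasFDerivAt_pushSmooth (ρ := ρ) hΦ.continuous hv y
  rw [h2.fderiv, ← jacTraceCLM_apply, ← (jacTraceCLM d).integral_comp_comm h1, ← integral_neg]
  congr 1 with x
  rw [jacTraceCLM_apply, jacTrace_smulRight]
  have hsm : ContDiff ℝ ∞ (ρ.normed (volume : Measure (Euc d))) := ρ.contDiff_normed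
  have h3 : HasFDerivAt (ρ.normed volume) (fderiv ℝ (ρ.normed volume) (y - Φ x)) (y - Φ x) :=
    (hsm.differentiable (by simp) _).hasFDerivAt
  have h4 : HasFDerivAt Φ (fderiv ℝ Φ x) x := (hΦ.differentiable (by simp) x).hasFDerivAt
  have h5 := h3.comp x (h4.const_sub y)
  have h6 : fderiv ℝ (fun x => ρ.normed volume (y - Φ x)) x = _ := h5.fderiv
  rw [h6]
  simp

end PushSmooth

/-! ### L² bound and weak approximation for the mollified push-forward -/

section PushSmoothBounds

variable {d : ℕ} {ρ : ContDiffBump (0 : Euc d)} {Φ : Euc d → Euc d} {Ω : Set (Euc d)}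
  {g : Euc d → Euc d}

/-- Two points that Φ maps within `ρ.rOut` of `y` are at most `4 * ρ.rOut = 8 * ρ.rIn` apart, so the
kernel lives on a ball of that radius. There it is at most the inverse volume of the ball of radius
`ρ.rIn`, and the volume ratio is `8 ^ d`; no change of variables is needed. -/
theorem integral_normed_sub_comp_le (hanti : ∀ x x', ‖x - x'‖ ≤ 2 * ‖Φ x - Φ x'‖)
    (hρ : ρ.rOut = 2 * ρ.rIn) (y : Euc d) :
    ∫ x in Ω, ρ.normed volume (y - Φ x) ≤ 8 ^ d := by
  by_cases hne : ∃ x₀, ‖y - Φ x₀‖ < ρ.rOut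
  swap
  · push Not at hne
    simp_rw [fun x => ρ.normed_eq_zero_of_le (hne x)]
    simp
  obtain ⟨x₀, hx₀⟩ := hne
  have hin := ρ.rIn_pos
  set V := volume.real (Metric.closedBall (0 : Euc d) ρ.rIn) with hV
  have hVpos : 0 < V := ENNReal.toReal_pos (Metric.measure_closedBall_pos _ _ ρ.rIn_pos).ne'
    measure_closedBall_lt_top.ne
  set S := Metric.closedBall x₀ (8 * ρ.rIn)
  have hint : Integrable (S.indicator fun _ => 1 / V) (volume : Measure (Euc d)) :=
    (integrable_indicator_iff Metric.isClosed_closedBall.measurableSet).2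
      (integrableOn_const measure_closedBall_lt_top.ne)
  have hle : ∀ x, ρ.normed volume (y - Φ x) ≤ S.indicator (fun _ => 1 / V) x := by
    intro x
    by_cases hx : ‖y - Φ x‖ < ρ.rOut
    · have : x ∈ S := by
        rw [Metric.mem_closedBall, dist_eq_norm]
        refine (hanti x x₀).trans ?_
        have : ‖Φ x - Φ x₀‖ ≤ ‖y - Φ x‖ + ‖y - Φ x₀‖ := by
          rw [norm_sub_rev y (Φ x)]
          exact norm_sub_le_norm_sub_add_norm_sub _ _ _
        linarith
      rw [indicator_of_mem this]
      exact ρ.normed_le_div_measure_closedBall_rIn volume _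
    · rw [ρ.normed_eq_zero_of_le (not_lt.1 hx)]
      exact indicator_nonneg (fun _ _ => by positivity) _
  calc ∫ x in Ω, ρ.normed volume (y - Φ x)
      ≤ ∫ x in Ω, S.indicator (fun _ => 1 / V) x :=
        integral_mono_of_nonneg (ae_of_all _ fun x => ρ.nonneg_normed _) hint.integrableOn
          (ae_of_all _ hle)
    _ ≤ ∫ x, S.indicator (fun _ => 1 / V) x :=
        setIntegral_le_integral hint
          (ae_of_all _ fun x => indicator_nonneg (fun _ _ => by positivity) _)
    _ = 8 ^ d := by
        rw [integral_indicator Metric.isClosed_closedBall.measurableSet, setIntegral_const,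
          smul_eq_mul, measureReal_def, Measure.addHaar_closedBall_mul _ _ (by norm_num) hin.le,
          ENNReal.toReal_mul, ← measureReal_def, ← hV, mul_one_div, mul_div_cancel_right₀ _ hVpos.ne']
        simp

/-- This is the Cauchy–Schwarz inequality for the kernel weight, obtained by pairing the value with
itself and using Young's inequality so that the term `‖w‖ ^ 2` can be absorbed. -/
theorem norm_pushSmooth_sq_le (hΦ : Continuous Φ) [IsFiniteMeasure (leb Ω)]
    {A : ℝ} (hA : 0 < A) (y : Euc d)
    (hAy : ∫ x in Ω, ρ.normed volume (y - Φ x) ≤ A) (hg : MemLp g 2 (leb Ω)) :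
    ‖pushSmooth ρ Φ Ω g y‖ ^ 2 ≤ A * ∫ x in Ω, ρ.normed volume (y - Φ x) * ‖g x‖ ^ 2 := by
  set w := pushSmooth ρ Φ Ω g y with hw
  have hg1 : Integrable g (leb Ω) := hg.integrable (by norm_num)
  have hg2 : Integrable (fun x => ‖g x‖ ^ 2) (leb Ω) := hg.integrable_norm_pow (by simp)
  have i1 := integrable_normed_smul (ρ := ρ) hΦ hg1 y
  have i2 : Integrable (fun x => ρ.normed volume (y - Φ x) * ‖g x‖ ^ 2) (leb Ω) :=
    integrable_normed_smul (ρ := ρ) hΦ hg2 y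
  have i3 : Integrable (fun x => ρ.normed volume (y - Φ x)) (leb Ω) := by
    simpa using integrable_normed_smul (ρ := ρ) hΦ (integrable_const (1 : ℝ) (μ := leb Ω)) y
  have h1 : 2 * ‖w‖ ^ 2 = ∫ x in Ω, 2 * inner ℝ w (ρ.normed volume (y - Φ x) • g x) := by
    rw [integral_const_mul, integral_inner i1, ← pushSmooth, ← hw, real_inner_self_eq_norm_sq]
  have h2 : ∫ x in Ω, 2 * inner ℝ w (ρ.normed volume (y - Φ x) • g x) ≤
      ∫ x in Ω, (A * (ρ.normed volume (y - Φ x) * ‖g x‖ ^ 2) +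
        (‖w‖ ^ 2 / A) * ρ.normed volume (y - Φ x)) := by
    refine integral_mono ((i1.const_inner w).const_mul 2)
      ((i2.const_mul A).add (i3.const_mul _)) fun x => ?_
    simp only [inner_smul_right]
    have hk := ρ.nonneg_normed (μ := volume) (y - Φ x)
    have hin : inner ℝ w (g x) ≤ ‖w‖ * ‖g x‖ := real_inner_le_norm _ _
    have hyoung : 2 * (‖w‖ * ‖g x‖) ≤ A * ‖g x‖ ^ 2 + ‖w‖ ^ 2 / A := by
      have h := two_mul_le_add_sq (A * ‖g x‖) ‖w‖
      have e : A * (A * ‖g x‖ ^ 2 + ‖w‖ ^ 2 / A) = (A * ‖g x‖) ^ 2 + ‖w‖ ^ 2 := by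
        field_simp
      refine le_of_mul_le_mul_left ?_ hA
      rw [e]; linarith
    nlinarith
  rw [← h1, integral_add (i2.const_mul A) (i3.const_mul _), integral_const_mul,
    integral_const_mul] at h2
  have h3 : ‖w‖ ^ 2 / A * ∫ x in Ω, ρ.normed volume (y - Φ x) ≤ ‖w‖ ^ 2 := by
    calc _ ≤ ‖w‖ ^ 2 / A * A := by gcongr
      _ = _ := div_mul_cancel₀ _ hA.ne'
  linarith

theorem integrable_prod_normed_mul {F : Type*} [NormedAddCommGroup F]
    [NormedSpace ℝ F] (hΦ : Continuous Φ) [IsFiniteMeasure (leb Ω)]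
    {f : Euc d × Euc d → F} (hf : Integrable f ((leb Ω).prod (leb Ω))) :
    Integrable (fun p : Euc d × Euc d => ρ.normed volume (p.1 - Φ p.2) • f p)
      ((leb Ω).prod (leb Ω)) := by
  obtain ⟨B, hB0, hB⟩ := ρ.exists_normed_le
  refine hf.bdd_smul (C := B) ?_ ?_
  · exact (ρ.continuous_normed.comp
      (continuous_fst.sub (hΦ.comp continuous_snd))).aestronglyMeasurable
  · exact ae_of_all _ fun x => by
      rw [Real.norm_of_nonneg (ρ.nonneg_normed _)]; exact hB _

theorem setIntegral_normed_sub_eq_one {z : Euc d} (hz : Metric.ball z ρ.rOut ⊆ Ω) :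
    ∫ y in Ω, ρ.normed volume (y - z) = 1 := by
  rw [setIntegral_eq_integral_of_forall_compl_eq_zero, integral_sub_right_eq_self,
    ρ.integral_normed]
  intro y hy
  refine ρ.normed_eq_zero_of_le ?_
  by_contra! h
  exact hy (hz (by rwa [Metric.mem_ball, dist_eq_norm]))

/-- Schur's test: one marginal of the kernel is at most `A`, while the other, in `y`, equals one
because the mollified mass stays in Ω. -/
theorem integral_norm_pushSmooth_sq_le (hΦ : Continuous Φ) [IsFiniteMeasure (leb Ω)]
    (hΩm : MeasurableSet Ω) {A : ℝ} (hA : 0 < A)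
    (hAy : ∀ y, ∫ x in Ω, ρ.normed volume (y - Φ x) ≤ A)
    (hball : ∀ x ∈ Ω, Metric.ball (Φ x) ρ.rOut ⊆ Ω) (hg : MemLp g 2 (leb Ω)) :
    ∫ y in Ω, ‖pushSmooth ρ Φ Ω g y‖ ^ 2 ≤ A * ∫ x in Ω, ‖g x‖ ^ 2 := by
  have hg2 : Integrable (fun x => ‖g x‖ ^ 2) (leb Ω) := hg.integrable_norm_pow (by simp)
  have hprod := integrable_prod_normed_mul (ρ := ρ) hΦ (hg2.comp_snd (leb Ω))
  calc ∫ y in Ω, ‖pushSmooth ρ Φ Ω g y‖ ^ 2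
      ≤ ∫ y in Ω, A * ∫ x in Ω, ρ.normed volume (y - Φ x) * ‖g x‖ ^ 2 :=
        integral_mono_of_nonneg (ae_of_all _ fun y => by positivity)
          (hprod.integral_prod_left.const_mul A)
          (ae_of_all _ fun y => norm_pushSmooth_sq_le hΦ hA y (hAy y) hg)
    _ = A * ∫ x in Ω, ∫ y in Ω, ρ.normed volume (y - Φ x) * ‖g x‖ ^ 2 := by
        rw [integral_const_mul, integral_integral_swap]
        exact hprod
    _ = A * ∫ x in Ω, ‖g x‖ ^ 2 := by
        congr 1
        refine setIntegral_congr_fun hΩm fun x hx => ?_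
        simp only [integral_mul_const]
        rw [setIntegral_normed_sub_eq_one (hball x hx), one_mul]

/-- After Fubini and the normalisation of the kernel in `y`, only ⟨ψ y, g x⟩ - ⟨ψ x, v x⟩ on the
support of the kernel matters. Replacing `g` by `v` costs `a * M`, replacing `ψ y` by `ψ x` costs
`η`. -/
theorem abs_integral_inner_pushSmooth_sub_le (hΦ : Continuous Φ) [IsFiniteMeasure (leb Ω)]
    (hΩm : MeasurableSet Ω) (hball : ∀ x ∈ Ω, Metric.ball (Φ x) ρ.rOut ⊆ Ω)
    {v ψ : Euc d → Euc d} (hv : Integrable v (leb Ω)) (hg : Integrable g (leb Ω))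
    {a M η : ℝ} (hgv : ∀ x, ‖g x - v x‖ ≤ a * ‖v x‖) (hψ : Continuous ψ) (hM : ∀ x, ‖ψ x‖ ≤ M)
    (hη : ∀ x ∈ Ω, ∀ y, ‖y - Φ x‖ < ρ.rOut → ‖ψ y - ψ x‖ ≤ η) :
    |(∫ y in Ω, inner ℝ (ψ y) (pushSmooth ρ Φ Ω g y)) - ∫ x in Ω, inner ℝ (ψ x) (v x)| ≤
      (a * M + η) * ∫ x in Ω, ‖v x‖ := by
  have hM0 : 0 ≤ M := (norm_nonneg _).trans (hM 0)
  have j1 : Integrable (fun p : Euc d × Euc d => inner ℝ (ψ p.1) (g p.2))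
      ((leb Ω).prod (leb Ω)) := by
    refine ((hg.norm.comp_snd (leb Ω)).const_mul M).mono'
      ((hψ.comp continuous_fst).aestronglyMeasurable.inner
        (hg.comp_snd (leb Ω)).aestronglyMeasurable) (ae_of_all _ fun p => ?_)
    exact (norm_inner_le_norm _ _).trans (by gcongr; exact hM _)
  have j2 : Integrable (fun x => inner ℝ (ψ x) (v x)) (leb Ω) := by
    refine (hv.norm.const_mul M).mono'
      (hψ.aestronglyMeasurable.inner hv.aestronglyMeasurable) (ae_of_all _ fun p => ?_)
    exact (norm_inner_le_norm _ _).trans (by gcongr; exact hM _)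
  have k1 := integrable_prod_normed_mul (ρ := ρ) hΦ j1
  have e1 : ∫ y in Ω, inner ℝ (ψ y) (pushSmooth ρ Φ Ω g y) =
      ∫ x in Ω, ∫ y in Ω, ρ.normed volume (y - Φ x) * inner ℝ (ψ y) (g x) := by
    rw [integral_integral_swap (f := fun x y => ρ.normed volume (y - Φ x) * inner ℝ (ψ y) (g x))
      k1.swap]
    congr 1 with y
    rw [pushSmooth, ← integral_inner (integrable_normed_smul hΦ hg y)]
    simp only [inner_smul_right]
  have k2 : Integrable (fun x => ∫ y in Ω, ρ.normed volume (y - Φ x) * inner ℝ (ψ y) (g x))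
      (leb Ω) := k1.integral_prod_right
  rw [e1, ← integral_sub k2 j2, ← integral_const_mul, ← Real.norm_eq_abs]
  refine norm_integral_le_of_norm_le (hv.norm.const_mul _) ?_
  refine (ae_restrict_iff' hΩm).2 (ae_of_all _ fun x hx => ?_)
  have hone := setIntegral_normed_sub_eq_one (ρ := ρ) (hball x hx)
  have hkint : Integrable (fun y => ρ.normed volume (y - Φ x)) (leb Ω) :=
    Integrable.of_integral_ne_zero (by rw [hone]; exact one_ne_zero)
  have hkψ : Integrable (fun y => ρ.normed volume (y - Φ x) * inner ℝ (ψ y) (g x)) (leb Ω) := by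
    refine (hkint.mul_const (M * ‖g x‖)).mono' (hkint.aestronglyMeasurable.mul
      (hψ.inner continuous_const).aestronglyMeasurable) (ae_of_all _ fun y => ?_)
    rw [norm_mul, Real.norm_of_nonneg (ρ.nonneg_normed _)]
    have := ρ.nonneg_normed (μ := volume) (y - Φ x)
    gcongr
    exact (norm_inner_le_norm _ _).trans (by gcongr; exact hM _)
  have e2 : inner ℝ (ψ x) (v x) = ∫ y in Ω, ρ.normed volume (y - Φ x) * inner ℝ (ψ x) (v x) := by
    rw [integral_mul_const, hone, one_mul]
  have e3 : (a * M + η) * ‖v x‖ =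
      ∫ y in Ω, ρ.normed volume (y - Φ x) * ((a * M + η) * ‖v x‖) := by
    rw [integral_mul_const, hone, one_mul]
  rw [e2, ← integral_sub hkψ (hkint.mul_const _), e3]
  refine norm_integral_le_of_norm_le (hkint.mul_const _) (ae_of_all _ fun y => ?_)
  rw [← mul_sub, norm_mul, Real.norm_of_nonneg (ρ.nonneg_normed _)]
  have hk := ρ.nonneg_normed (μ := volume) (y - Φ x)
  by_cases hy : ‖y - Φ x‖ < ρ.rOut
  · gcongr
    have hsplit : inner ℝ (ψ y) (g x) - inner ℝ (ψ x) (v x) =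
        inner ℝ (ψ y) (g x - v x) + inner ℝ (ψ y - ψ x) (v x) := by
      rw [inner_sub_right, inner_sub_left]; ring
    rw [hsplit]
    have b1 : ‖inner ℝ (ψ y) (g x - v x)‖ ≤ M * (a * ‖v x‖) :=
      (norm_inner_le_norm _ _).trans (mul_le_mul (hM y) (hgv x) (norm_nonneg _) hM0)
    have b2 : ‖inner ℝ (ψ y - ψ x) (v x)‖ ≤ η * ‖v x‖ :=
      (norm_inner_le_norm _ _).trans
        (mul_le_mul_of_nonneg_right (hη x hx y hy) (norm_nonneg _))
    refine (norm_add_le _ _).trans ?_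
    linarith
  · rw [ρ.normed_eq_zero_of_le (not_lt.1 hy)]; simp

end PushSmoothBounds

/-! ### Fields orthogonal to all gradients belong to H -/

theorem L2_norm_sq_eq_integral {α : Type*} [MeasurableSpace α] {μ : Measure α} {F : Type*}
    [NormedAddCommGroup F] [InnerProductSpace ℝ F] (f : Lp F 2 μ) :
    ‖f‖ ^ 2 = ∫ x, ‖f x‖ ^ 2 ∂μ := by
  rw [← real_inner_self_eq_norm_sq, L2.inner_def]
  simp only [real_inner_self_eq_norm_sq]

/-- A field that is orthogonal to all gradients can be approximated by smooth compactly supported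
divergence-free fields, boundedly and weakly in `L²`. -/
theorem eventually_exists_mem_HSol {d : ℕ} {Ω : Set (Euc d)} (hΩ : IsBoundedLipschitzDomain Ω)
    (v : YSpace Ω)
    (hv : ∀ q : Euc d → ℝ, ContDiff ℝ 1 q → ∫ x in Ω, fderiv ℝ q x (v x) = 0) :
    ∃ L r : ℝ, ∀ᶠ t : ℝ in 𝓝[>] 0, ∃ w ∈ HSol Ω, ‖w‖ ^ 2 ≤ 8 ^ d * 4 * ‖v‖ ^ 2 ∧
      ∀ (ψ : Euc d → Euc d) (M η : ℝ), Continuous ψ → (∀ x, ‖ψ x‖ ≤ M) →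
        (∀ x y, dist x y < t * r → ‖ψ x - ψ y‖ ≤ η) →
        |(∫ y in Ω, inner ℝ (ψ y) (w y)) - ∫ x in Ω, inner ℝ (ψ x) (v x)| ≤
          (t * L * M + η) * ∫ x in Ω, ‖v x‖ := by
  obtain ⟨X, hX, hXs, c, hc, t₀, ht₀, hball⟩ := hΩ.exists_inward_field
  obtain ⟨L, hL⟩ := hX.lipschitzWith_of_hasCompactSupport hXs (by simp)
  obtain ⟨B, hB⟩ := hXs.exists_bound_of_continuous hX.continuous
  have hΩm : MeasurableSet Ω := hΩ.isOpen.measurableSet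
  have : IsFiniteMeasure (leb Ω) := ⟨by simpa using hΩ.isBounded.measure_lt_top⟩
  -- `L` is a Lipschitz constant of `X`; mass moves by less than `c * t / 2` through mollification
  -- and at most `t * B` through Φ.
  refine ⟨L, c + B, ?_⟩
  -- This makes the inverse of Φ 2-Lipschitz on its range and gives `‖g x‖ ≤ 2 * ‖v x‖`, the source
  -- of the factor 4 in the norm bound.
  have hev : ∀ᶠ t : ℝ in 𝓝[>] 0, t * L < 1 / 2 := by
    have : Tendsto (fun t : ℝ => t * L) (𝓝[>] 0) (𝓝 (0 * L)) :=
      ((continuous_id.mul continuous_const).tendsto 0).mono_left nhdsWithin_le_nhds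
    exact this.eventually_lt_const (by simp)
  filter_upwards [hev, Ioo_mem_nhdsGT ht₀] with t htL ⟨ht, htt₀⟩
  set Φ : Euc d → Euc d := fun x => x + t • X x with hΦdef
  have hΦ : ContDiff ℝ ∞ Φ := contDiff_id.add (hX.const_smul t)
  have hDΦ : ∀ x z, fderiv ℝ Φ x z = z + t • fderiv ℝ X x z := by
    intro x z
    have h1 := (hasFDerivAt_id x).add
      (((hX.differentiable (by simp) x).hasFDerivAt).const_smul t)
    have h2 : fderiv ℝ Φ x = _ := h1.fderiv
    rw [h2]; simp
  have hct : 0 < c * t := by positivity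
  -- Twice the outer radius is `c * t`, the radius of the ball around `Φ x` known to lie in Ω.
  let ρ : ContDiffBump (0 : Euc d) := ⟨c * t / 4, c * t / 2, by positivity, by linarith⟩
  have hanti : ∀ x x', ‖x - x'‖ ≤ 2 * ‖Φ x - Φ x'‖ := by
    intro x x'
    have h1 : ‖t • (X x - X x')‖ ≤ t * (L * ‖x - x'‖) := by
      rw [norm_smul, Real.norm_of_nonneg ht.le]
      gcongr
      simpa [dist_eq_norm] using hL.dist_le_mul x x'
    have h2 : x - x' = (Φ x - Φ x') - t • (X x - X x') := by
      simp only [hΦdef, smul_sub]; abel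
    have h3 : ‖x - x'‖ ≤ ‖Φ x - Φ x'‖ + ‖t • (X x - X x')‖ := by
      conv_lhs => rw [h2]
      exact norm_sub_le _ _
    have := norm_nonneg (x - x')
    nlinarith
  have hb2 : ∀ x ∈ Ω, Metric.ball (Φ x) (2 * ρ.rOut) ⊆ Ω := fun x hx => by
    have : 2 * ρ.rOut = c * t := mul_div_cancel₀ (c * t) two_ne_zero
    rw [this]
    exact hball t ht htt₀.le x hx
  have hb1 : ∀ x ∈ Ω, Metric.ball (Φ x) ρ.rOut ⊆ Ω := fun x hx =>
    (Metric.ball_subset_ball (by linarith [ρ.rOut_pos])).trans (hb2 x hx)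
  set g : Euc d → Euc d := fun x => fderiv ℝ Φ x (v x) with hg
  have hgv : ∀ x, ‖g x - v x‖ ≤ t * L * ‖v x‖ := by
    intro x
    change ‖fderiv ℝ Φ x (v x) - v x‖ ≤ _
    rw [hDΦ, add_sub_cancel_left, norm_smul, Real.norm_of_nonneg ht.le, mul_assoc]
    gcongr
    exact (ContinuousLinearMap.le_opNorm _ _).trans
      (mul_le_mul_of_nonneg_right (norm_fderiv_le_of_lipschitz ℝ hL) (norm_nonneg _))
  have hg2v : ∀ x, ‖g x‖ ≤ 2 * ‖v x‖ := fun x => by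
    have h1 := hgv x
    have h2 : ‖g x‖ ≤ ‖g x - v x‖ + ‖v x‖ := by
      simpa using norm_add_le (g x - v x) (v x)
    nlinarith [norm_nonneg (v x)]
  have hv2 : MemLp v 2 (leb Ω) := Lp.memLp v
  have hgmeas : AEStronglyMeasurable g (leb Ω) :=
    (ContinuousLinearMap.apply ℝ (Euc d)).flip.aestronglyMeasurable_comp₂
      (hΦ.continuous_fderiv (by simp)).aestronglyMeasurable hv2.1
  have hgL2 : MemLp g 2 (leb Ω) := hv2.of_le_mul hgmeas (ae_of_all _ hg2v)
  have hv1 : Integrable v (leb Ω) := hv2.integrable (by norm_num)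
  have hg1 : Integrable g (leb Ω) := hgL2.integrable (by norm_num)
  set W := pushSmooth ρ Φ Ω g with hW
  have htest : IsTestFunction Ω W := isTestFunction_pushSmooth hΦ hΩ.isBounded hΩm hg1 hb2
  have hWL2 : MemLp W 2 (leb Ω) :=
    (htest.1.continuous.memLp_of_hasCompactSupport htest.2.1)
  have hdiv : ∀ y, jacTrace (fderiv ℝ W y) = 0 := by
    intro y
    rw [hW, jacTrace_fderiv_pushSmooth hΦ hg1, hv _ _, neg_zero]
    have : ContDiff ℝ ∞ (fun x => ρ.normed volume (y - Φ x)) :=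
      ρ.contDiff_normed.comp (contDiff_const.sub hΦ)
    exact this.of_le (by simp)
  have hcoe := hWL2.coeFn_toLp
  refine ⟨hWL2.toLp W, ?_, ?_, ?_⟩
  · exact Submodule.le_topologicalClosure _
      (Submodule.subset_span ⟨W, htest, hdiv, hcoe⟩)
  · rw [L2_norm_sq_eq_integral, L2_norm_sq_eq_integral]
    have h1 : ∫ x in Ω, ‖hWL2.toLp W x‖ ^ 2 = ∫ x in Ω, ‖W x‖ ^ 2 :=
      integral_congr_ae (hcoe.mono fun x hx => by simp only [hx])
    have h2 := integral_norm_pushSmooth_sq_le hΦ.continuous hΩm (by positivity)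
      (fun y => integral_normed_sub_comp_le (ρ := ρ) (Ω := Ω) hanti
        (by change c * t / 2 = 2 * (c * t / 4); ring) y) hb1 hgL2
    have h3 : ∫ x in Ω, ‖g x‖ ^ 2 ≤ ∫ x in Ω, 4 * ‖v x‖ ^ 2 := by
      refine integral_mono (hgL2.integrable_norm_pow (by simp))
        ((hv2.integrable_norm_pow (by simp)).const_mul 4) fun x => ?_
      have := pow_le_pow_left₀ (norm_nonneg _) (hg2v x) 2
      simp only at this ⊢
      linarith
    rw [integral_const_mul] at h3
    rw [h1, mul_assoc]
    exact h2.trans (by gcongr)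
  · intro ψ M η hψ hM hη
    have h1 : ∫ y in Ω, inner ℝ (ψ y) (hWL2.toLp W y) = ∫ y in Ω, inner ℝ (ψ y) (W y) :=
      integral_congr_ae (hcoe.mono fun x hx => by simp only [hx])
    rw [h1]
    refine abs_integral_inner_pushSmooth_sub_le hΦ.continuous hΩm hb1 hv1 hg1 hgv hψ hM ?_
    intro x _ y hy
    refine hη y x ?_
    have hρ : ρ.rOut = c * t / 2 := rfl
    rw [hρ] at hy
    have h2 : y - x = (y - Φ x) + t • X x := by simp only [hΦdef]; abel
    rw [dist_eq_norm, h2]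
    refine (norm_add_le _ _).trans_lt ?_
    rw [norm_smul, Real.norm_of_nonneg ht.le]
    have := hB x
    nlinarith

/-- Since H is closed, it suffices that `v` is orthogonal to each `u` in H^⊥. Replacing `u` by a
nearby continuous compactly supported ψ, the approximants `w` in H have nearly the same pairing with
ψ as `v`, and `inner ℝ u w = 0`; bounded norms control the error from ψ. -/
theorem mem_HSol_of_forall_integral_fderiv_eq_zero {d : ℕ} {Ω : Set (Euc d)}
    (hΩ : IsBoundedLipschitzDomain Ω) (v : YSpace Ω)
    (hv : ∀ q : Euc d → ℝ, ContDiff ℝ 1 q → ∫ x in Ω, fderiv ℝ q x (v x) = 0) :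
    v ∈ HSol Ω := by
  have : IsFiniteMeasure (leb Ω) := ⟨by simpa using hΩ.isBounded.measure_lt_top⟩
  obtain ⟨L, r, hw⟩ := eventually_exists_mem_HSol hΩ v hv
  have hclosed : IsClosed (HSol Ω : Set (YSpace Ω)) := Submodule.isClosed_topologicalClosure _
  have : CompleteSpace (HSol Ω) := hclosed.completeSpace_coe
  rw [← (HSol Ω).orthogonal_orthogonal, Submodule.mem_orthogonal]
  intro u hu
  set C : ℝ := √(8 ^ d * 4) with hC
  set I : ℝ := ∫ x in Ω, ‖v x‖ with hI
  have hI0 : 0 ≤ I := integral_nonneg fun x => norm_nonneg _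
  suffices h : ∀ δ > 0, |inner ℝ u v| ≤ δ * (‖v‖ + C * ‖v‖ + I) by
    have h0 : Tendsto (fun δ : ℝ => δ * (‖v‖ + C * ‖v‖ + I)) (𝓝[>] 0)
        (𝓝 (0 * (‖v‖ + C * ‖v‖ + I))) :=
      ((continuous_id.mul continuous_const).tendsto 0).mono_left nhdsWithin_le_nhds
    rw [zero_mul] at h0
    have := ge_of_tendsto h0 (eventually_nhdsWithin_of_forall h)
    exact abs_eq_zero.1 (le_antisymm this (abs_nonneg _))
  intro δ hδ
  obtain ⟨ψ, hψs, hψd, hψc, hψ2⟩ := (Lp.memLp u).exists_hasCompactSupport_eLpNorm_sub_le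
    (by simp) (ε := ENNReal.ofReal δ) (by simpa using hδ)
  have hcoe := hψ2.coeFn_toLp
  have hdist : ‖u - hψ2.toLp ψ‖ ≤ δ := by
    rw [Lp.norm_def]
    refine ENNReal.toReal_le_of_le_ofReal hδ.le (le_trans (le_of_eq ?_) hψd)
    refine eLpNorm_congr_ae ((Lp.coeFn_sub _ _).trans ?_)
    filter_upwards [hcoe] with x hx
    simp [hx]
  obtain ⟨M, hM⟩ := hψs.exists_bound_of_continuous hψc
  have huc := hψs.uniformContinuous_of_continuous hψc
  obtain ⟨r', hr', huc⟩ := Metric.uniformContinuous_iff.1 huc (δ / 2) (by positivity)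
  have hev1 : ∀ᶠ t : ℝ in 𝓝[>] 0, t * r < r' := by
    have : Tendsto (fun t : ℝ => t * r) (𝓝[>] 0) (𝓝 (0 * r)) :=
      ((continuous_id.mul continuous_const).tendsto 0).mono_left nhdsWithin_le_nhds
    exact this.eventually_lt_const (by simpa using hr')
  have hev2 : ∀ᶠ t : ℝ in 𝓝[>] 0, t * (L * M) < δ / 2 := by
    have : Tendsto (fun t : ℝ => t * (L * M)) (𝓝[>] 0) (𝓝 (0 * (L * M))) :=
      ((continuous_id.mul continuous_const).tendsto 0).mono_left nhdsWithin_le_nhds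
    exact this.eventually_lt_const (by simpa using half_pos hδ)
  obtain ⟨t, ⟨w, hwH, hwn, hwψ⟩, ht1, ht2⟩ := (hw.and (hev1.and hev2)).exists
  have h1 := hwψ ψ M (δ / 2) hψc hM fun x y hxy => by
    rw [← dist_eq_norm]; exact (huc (hxy.trans ht1)).le
  have hinner : ∀ z : YSpace Ω, inner ℝ (hψ2.toLp ψ) z = ∫ x in Ω, inner ℝ (ψ x) (z x) := by
    intro z
    rw [L2.inner_def]
    exact integral_congr_ae (hcoe.mono fun x hx => by simp only [hx])
  rw [← hinner, ← hinner] at h1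
  have h2 : |inner ℝ (hψ2.toLp ψ) w - inner ℝ (hψ2.toLp ψ) v| ≤ δ * I :=
    h1.trans (mul_le_mul_of_nonneg_right (by linarith) hI0)
  have h3 : inner ℝ u w = 0 := by
    rw [real_inner_comm]; exact hu w hwH
  have hwC : ‖w‖ ≤ C * ‖v‖ := by
    refine abs_le_of_sq_le_sq' ?_ (by positivity) |>.2
    rw [mul_pow, hC, Real.sq_sqrt (by positivity)]
    exact hwn
  have e : inner ℝ u v = inner ℝ (u - hψ2.toLp ψ) v - inner ℝ (u - hψ2.toLp ψ) w -
      (inner ℝ (hψ2.toLp ψ) w - inner ℝ (hψ2.toLp ψ) v) := by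
    rw [inner_sub_left, inner_sub_left, h3]; ring
  have h4 : |inner ℝ (u - hψ2.toLp ψ) v| ≤ δ * ‖v‖ :=
    (abs_real_inner_le_norm _ _).trans (by gcongr)
  have h5 : |inner ℝ (u - hψ2.toLp ψ) w| ≤ δ * (C * ‖v‖) :=
    (abs_real_inner_le_norm _ _).trans (by gcongr)
  rw [e]
  refine (abs_sub _ _).trans ?_
  have := abs_sub (inner ℝ (u - hψ2.toLp ψ) v) (inner ℝ (u - hψ2.toLp ψ) w)
  linarith

/-! ### Weak derivatives and integration by parts -/

theorem IsTestFunction.integrable_smul {d : ℕ} {F : Type*} [NormedAddCommGroup F]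
    [NormedSpace ℝ F] {Ω : Set (Euc d)} {φ : Euc d → ℝ} (hφ : IsTestFunction Ω φ)
    {G : Euc d → F} (hG : LocallyIntegrableOn G Ω) : Integrable (fun x => φ x • G x) := by
  have h1 : IntegrableOn G (tsupport φ) := hG.integrableOn_compact_subset hφ.2.2 hφ.2.1
  obtain ⟨C, hC⟩ := hφ.2.1.exists_bound_of_continuous hφ.1.continuous
  have h2 : IntegrableOn (fun x => φ x • G x) (tsupport φ) :=
    Integrable.bdd_smul (C := C) h1 hφ.1.continuous.aestronglyMeasurable (ae_of_all _ hC)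
  refine (integrableOn_iff_integrable_of_support_subset ?_).1 h2
  exact (Function.support_smul_subset_left φ G).trans (subset_tsupport φ)

/-- Weak derivatives are unique up to null sets. -/
theorem HasWeakDeriv.ae_eq {d : ℕ} {Ω : Set (Euc d)} (hΩ : IsOpen Ω) {f : Euc d → Euc d}
    {G G' : Euc d → Euc d →L[ℝ] Euc d} (hG : HasWeakDeriv Ω f G) (hG' : HasWeakDeriv Ω f G') :
    G =ᵐ[leb Ω] G' := by
  have key := hΩ.ae_eq_zero_of_integral_contDiff_smul_eq_zero (μ := volume)
    (hG.2.1.sub hG'.2.1) fun φ h1 h2 h3 => ?_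
  · rw [Filter.EventuallyEq, ae_restrict_iff' hΩ.measurableSet]
    filter_upwards [key] with x hx hxΩ
    exact sub_eq_zero.1 (hx hxΩ)
  · have hφ : IsTestFunction Ω φ := ⟨h1, h2, h3⟩
    have i1 := hφ.integrable_smul hG.2.1
    have i2 := hφ.integrable_smul hG'.2.1
    have hset : ∀ K : Euc d → Euc d →L[ℝ] Euc d,
        ∫ x in Ω, φ x • K x = ∫ x, φ x • K x := fun K =>
      setIntegral_eq_integral_of_forall_compl_eq_zero fun x hx => by
        rw [image_eq_zero_of_notMem_tsupport fun h => hx (h3 h)]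
        exact zero_smul ℝ (K x)
    simp only [Pi.sub_apply, smul_sub]
    rw [integral_sub i1 i2, sub_eq_zero, ← hset, ← hset]
    ext1 w
    rw [ContinuousLinearMap.integral_apply i1.integrableOn,
      ContinuousLinearMap.integral_apply i2.integrableOn]
    have e1 := hG.2.2 φ hφ w
    have e2 := hG'.2.2 φ hφ w
    exact neg_injective (e1.symm.trans e2)

theorem integral_fderiv_apply_eq_neg_integral_jacTrace_mul {d : ℕ} {φ : Euc d → Euc d}
    (hφ : ContDiff ℝ 1 φ) (hφs : HasCompactSupport φ) {q : Euc d → ℝ} (hq : ContDiff ℝ 1 q) :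
    ∫ x, fderiv ℝ q x (φ x) = -∫ x, jacTrace (fderiv ℝ φ x) * q x := by
  have hφi : ∀ i : Fin d, ContDiff ℝ 1 (fun x => φ x i) := fun i =>
    (EuclideanSpace.proj i : Euc d →L[ℝ] ℝ).contDiff.comp hφ
  have hφis : ∀ i : Fin d, HasCompactSupport (fun x => φ x i) := fun i =>
    hφs.comp_left (g := fun z : Euc d => z i) rfl
  have hD : ∀ (i : Fin d) (x w : Euc d), fderiv ℝ (fun x => φ x i) x w = fderiv ℝ φ x w i := by
    intro i x w
    have h1 := (EuclideanSpace.proj i : Euc d →L[ℝ] ℝ).hasFDerivAt.comp x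
      (hφ.differentiable (by simp) x).hasFDerivAt
    have h2 : fderiv ℝ (fun x => φ x i) x = _ := h1.fderiv
    rw [h2]; rfl
  have hcq := hq.continuous_fderiv one_ne_zero
  have i1 : ∀ i : Fin d, Integrable
      (fun x => fderiv ℝ q x (EuclideanSpace.single i 1) * φ x i) := fun i =>
    Continuous.integrable_of_hasCompactSupport
      ((hcq.clm_apply continuous_const).mul (hφi i).continuous) ((hφis i).mul_left)
  have i2 : ∀ i : Fin d, Integrable
      (fun x => q x * fderiv ℝ (fun x => φ x i) x (EuclideanSpace.single i 1)) := fun i =>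
    Continuous.integrable_of_hasCompactSupport
      (hq.continuous.mul (((hφi i).continuous_fderiv one_ne_zero).clm_apply continuous_const))
      (((hφis i).fderiv_apply (𝕜 := ℝ) _).mul_left)
  have i3 : ∀ i : Fin d, Integrable (fun x => q x * φ x i) := fun i =>
    Continuous.integrable_of_hasCompactSupport
      (hq.continuous.mul (hφi i).continuous) ((hφis i).mul_left)
  have e1 : ∀ x, fderiv ℝ q x (φ x) =
      ∑ i, fderiv ℝ q x (EuclideanSpace.single i 1) * φ x i := by
    intro x
    conv_lhs => rw [← (EuclideanSpace.basisFun (Fin d) ℝ).sum_repr (φ x)]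
    simp [mul_comm]
  have e2 : ∀ x, jacTrace (fderiv ℝ φ x) * q x =
      ∑ i, q x * fderiv ℝ (fun x => φ x i) x (EuclideanSpace.single i 1) := by
    intro x
    rw [jacTrace, Finset.sum_mul]
    exact Finset.sum_congr rfl fun i _ => by rw [hD, mul_comm]
  simp_rw [e1, e2]
  rw [integral_finsetSum _ fun i _ => i1 i, integral_finsetSum _ fun i _ => i2 i,
    ← Finset.sum_neg_distrib]
  refine Finset.sum_congr rfl fun i _ => ?_
  rw [integral_mul_fderiv_eq_neg_fderiv_mul_of_integrable (i1 i) (i2 i) (i3 i)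
    (fun x _ => hq.differentiable one_ne_zero x)
    (fun x _ => (hφi i).differentiable one_ne_zero x), neg_neg]

/-- A bounded field of functionals acts continuously on `L¹`. -/
theorem tendsto_integral_clm_apply {α : Type*} [MeasurableSpace α] {μ : Measure α} {F : Type*}
    [NormedAddCommGroup F] [NormedSpace ℝ F] {A : α → F →L[ℝ] ℝ} (hA : AEStronglyMeasurable A μ)
    {M : ℝ} (hM : ∀ᵐ x ∂μ, ‖A x‖ ≤ M) {f : α → F} (hf : MemLp f 1 μ) {f' : ℕ → α → F}
    (hf' : ∀ n, MemLp (f' n) 1 μ)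
    (hlim : Tendsto (fun n => eLpNorm (fun x => f x - f' n x) 1 μ) atTop (𝓝 0)) :
    Tendsto (fun n => ∫ x, A x (f' n x) ∂μ) atTop (𝓝 (∫ x, A x (f x) ∂μ)) := by
  have hm : ∀ {g : α → F}, MemLp g 1 μ → MemLp (fun x => A x (g x)) 1 μ := fun {g} hg =>
    hg.of_le_mul (c := M)
      ((ContinuousLinearMap.apply ℝ ℝ).flip.aestronglyMeasurable_comp₂ hA hg.1)
      (hM.mono fun x hx => (ContinuousLinearMap.le_opNorm _ _).trans (by gcongr))
  refine tendsto_integral_of_L1' _ (hm hf).1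
    (Eventually.of_forall fun n => memLp_one_iff_integrable.1 (hm (hf' n))) ?_
  have h0 : Tendsto (fun n => ENNReal.ofReal M * eLpNorm (fun x => f x - f' n x) 1 μ) atTop
      (𝓝 0) := by
    simpa using ENNReal.Tendsto.const_mul hlim (Or.inr ENNReal.ofReal_ne_top)
  refine tendsto_of_tendsto_of_tendsto_of_le_of_le tendsto_const_nhds h0 (fun _ => zero_le)
    fun n => ?_
  refine eLpNorm_le_mul_eLpNorm_of_ae_le_mul (hM.mono fun x hx => ?_) 1
  rw [Pi.sub_apply, ← map_sub, norm_sub_rev (f x)]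
  exact (ContinuousLinearMap.le_opNorm _ _).trans (by gcongr)

theorem exists_bound_of_isBounded {d : ℕ} {Ω : Set (Euc d)} (hΩ : Bornology.IsBounded Ω)
    (hΩm : MeasurableSet Ω) {F : Type*} [NormedAddCommGroup F] {f : Euc d → F}
    (hf : Continuous f) : ∃ M, ∀ᵐ x ∂(leb Ω), ‖f x‖ ≤ M := by
  obtain ⟨M, hM⟩ := hΩ.isCompact_closure.exists_bound_of_continuousOn hf.continuousOn
  exact ⟨M, (ae_restrict_iff' hΩm).2 (ae_of_all _ fun x hx => hM x (subset_closure hx))⟩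

/-- Integration by parts in `W^{1,1}_0`. -/
theorem MemW110.integrable_weakDiv_and_integral_fderiv {d : ℕ} {Ω : Set (Euc d)}
    (hΩ : IsOpen Ω) (hΩb : Bornology.IsBounded Ω) {z : Euc d → Euc d} (hz : MemW110 Ω z) :
    Integrable (weakDiv Ω z) (leb Ω) ∧ ∀ q : Euc d → ℝ, ContDiff ℝ 1 q →
      ∫ x in Ω, fderiv ℝ q x (z x) = -∫ x in Ω, weakDiv Ω z x * q x := by
  obtain ⟨hz1, G, hG, hw, φ, hφ, hφ0, hφ1⟩ := hz
  have hex : ∃ G, HasWeakDeriv Ω z G := ⟨G, hw⟩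
  -- `weakDeriv` is an arbitrary choice, so uniqueness is needed to identify it with the L¹ limit
  -- `G` of the derivatives of the test fields.
  have hae : weakDiv Ω z =ᵐ[leb Ω] fun x => jacTrace (G x) := by
    have h1 : HasWeakDeriv Ω z (weakDeriv Ω z) := by
      rw [weakDeriv, dif_pos hex]; exact hex.choose_spec
    filter_upwards [h1.ae_eq hΩ hw] with x hx
    rw [weakDiv, hx]
  have hGi : Integrable G (leb Ω) := memLp_one_iff_integrable.1 hG
  have hdiv : Integrable (fun x => jacTrace (G x)) (leb Ω) := by
    simpa only [jacTraceCLM_apply] using (jacTraceCLM d).integrable_comp hGi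
  refine ⟨hdiv.congr hae.symm, fun q hq => ?_⟩
  have hm := hΩ.measurableSet
  have hcq := hq.continuous_fderiv one_ne_zero
  have hA : Continuous (fun x => q x • jacTraceCLM d) := hq.continuous.smul continuous_const
  obtain ⟨M, hM⟩ := exists_bound_of_isBounded hΩb hm hcq
  obtain ⟨M', hM'⟩ := exists_bound_of_isBounded
    (F := (Euc d →L[ℝ] Euc d) →L[ℝ] ℝ) hΩb hm hA
  have t1 := tendsto_integral_clm_apply hcq.aestronglyMeasurable hM hz1
    (fun n => ((hφ n).1.continuous.memLp_of_hasCompactSupport (hφ n).2.1)) hφ0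
  have t2 := tendsto_integral_clm_apply hA.aestronglyMeasurable hM' hG
    (fun n => (((hφ n).1.continuous_fderiv (by simp)).memLp_of_hasCompactSupport
      ((hφ n).2.1.fderiv (𝕜 := ℝ)))) hφ1
  have e : ∀ n, ∫ x in Ω, fderiv ℝ q x (φ n x) =
      -∫ x in Ω, (q x • jacTraceCLM d) (fderiv ℝ (φ n) x) := by
    intro n
    have hsub := (hφ n).2.2
    rw [setIntegral_eq_integral_of_forall_compl_eq_zero fun x hx => by
        rw [image_eq_zero_of_notMem_tsupport fun h => hx (hsub h), map_zero],
      setIntegral_eq_integral_of_forall_compl_eq_zero fun x hx => by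
        rw [fderiv_of_notMem_tsupport ℝ fun h => hx (hsub h), map_zero],
      integral_fderiv_apply_eq_neg_integral_jacTrace_mul ((hφ n).1.of_le (by simp))
        (hφ n).2.1 hq]
    simp only [smul_apply, jacTraceCLM_apply, smul_eq_mul, mul_comm]
  simp_rw [e] at t1
  rw [tendsto_nhds_unique t1 t2.neg]
  congr 1
  refine integral_congr_ae (hae.mono fun x hx => ?_)
  simp only [hx, smul_apply, jacTraceCLM_apply, smul_eq_mul, mul_comm]

/-! ### Discretely divergence-free fields against gradients -/

/-- Finitely many compact cells cover Ω. The bound makes the product of a discrete pressure with a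
merely integrable divergence integrable. -/
theorem IsPiecewisePoly.exists_ae_bound {d : ℕ} {Ω : Set (Euc d)} (hΩm : MeasurableSet Ω) {h : ℝ}
    {K : Geometry.SimplicialComplex ℝ (Euc d)} (hK : IsTriangulation Ω h K) {m : ℕ}
    {f : Euc d → ℝ} (hf : IsPiecewisePoly Ω K m f) : ∃ B, ∀ᵐ x ∂(leb Ω), ‖f x‖ ≤ B := by
  have hfin : (cells K).Finite := hK.finite.subset fun s hs => hs.1
  have hcell : ∀ s ∈ cells K, ∃ B : ℝ, ∀ᵐ x ∂(leb Ω),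
      x ∈ convexHull ℝ (s : Set (Euc d)) → ‖f x‖ ≤ B := by
    intro s hs
    obtain ⟨p, -, hp⟩ := hf s hs
    have hc : Continuous (fun x : Euc d => MvPolynomial.eval (fun j => x j) p) :=
      (MvPolynomial.continuous_eval p).comp (by fun_prop)
    have hcomp : IsCompact (convexHull ℝ (s : Set (Euc d))) :=
      s.finite_toSet.isCompact_convexHull ℝ
    obtain ⟨B, hB⟩ := hcomp.exists_bound_of_continuousOn hc.continuousOn
    refine ⟨B, hp.mono fun x hx hxs => ?_⟩
    rw [hx hxs]; exact hB x hxs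
  choose! B hB using hcell
  obtain ⟨B₀, hB₀⟩ := (hfin.image B).bddAbove
  refine ⟨B₀, ?_⟩
  have hall : ∀ᵐ x ∂(leb Ω), ∀ s ∈ cells K,
      x ∈ convexHull ℝ (s : Set (Euc d)) → ‖f x‖ ≤ B s :=
    (ae_ball_iff hfin.countable).2 hB
  have hΩae : ∀ᵐ x ∂(leb Ω), x ∈ Ω := ae_restrict_mem hΩm
  filter_upwards [hall, hΩae] with x hx hxΩ
  have hsp : x ∈ K.space := by rw [hK.space_eq]; exact subset_closure hxΩ
  obtain ⟨s, hs, hxs⟩ := Geometry.SimplicialComplex.mem_space_iff.1 hsp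
  obtain ⟨t, ht, hst⟩ := hK.pure s hs
  have hxt := convexHull_mono (Finset.coe_subset.2 hst) hxs
  exact (hx t ht hxt).trans (hB₀ (mem_image_of_mem B ht))

/-- Discretely divergence-free fields are almost orthogonal to gradients. -/
theorem enorm_integral_fderiv_le_of_mem_discDivFree {d : ℕ} {Ω : Set (Euc d)} (hΩ : IsOpen Ω)
    (hΩb : Bornology.IsBounded Ω) {V : Submodule ℝ (YSpace Ω)} {Q : Submodule ℝ (Lp ℝ 1 (leb Ω))}
    {z : YSpace Ω} (hz : z ∈ discDivFree Ω V Q) {q : Euc d → ℝ} (hq : ContDiff ℝ 1 q)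
    {qh : Lp ℝ 1 (leb Ω)} (hqh : qh ∈ Q) {B : ℝ} (hB : ∀ᵐ x ∂(leb Ω), ‖qh x‖ ≤ B)
    {r s : ℝ≥0∞} [ENNReal.HolderTriple r s 1] :
    ‖∫ x in Ω, fderiv ℝ q x (z x)‖ₑ ≤
      eLpNorm (weakDiv Ω z) r (leb Ω) * eLpNorm (fun x => q x - qh x) s (leb Ω) := by
  obtain ⟨hdiv, hibp⟩ := hz.2.1.integrable_weakDiv_and_integral_fderiv hΩ hΩb
  obtain ⟨M, hM⟩ := exists_bound_of_isBounded hΩb hΩ.measurableSet hq.continuous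
  have hqm : AEStronglyMeasurable q (leb Ω) := hq.continuous.aestronglyMeasurable
  have hqhm : AEStronglyMeasurable qh (leb Ω) := Lp.aestronglyMeasurable qh
  have i1 : Integrable (fun x => weakDiv Ω z x * q x) (leb Ω) := hdiv.mul_bdd hqm hM
  have i2 : Integrable (fun x => weakDiv Ω z x * qh x) (leb Ω) := hdiv.mul_bdd hqhm hB
  have e : ∫ x in Ω, weakDiv Ω z x * q x = ∫ x in Ω, weakDiv Ω z x * (q x - qh x) := by
    simp_rw [mul_sub]
    rw [integral_sub i1 i2, hz.2.2 qh hqh, sub_zero]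
  rw [hibp q hq, e, enorm_neg]
  refine (enorm_integral_le_lintegral_enorm _).trans ?_
  rw [← eLpNorm_one_eq_lintegral_enorm]
  exact eLpNorm_smul_le_mul_eLpNorm (p := r) (q := s) (r := 1) (f := fun x => q x - qh x)
    (φ := weakDiv Ω z) (hqm.sub hqhm) hdiv.aestronglyMeasurable

/-! ### Weak convergence along a subsequence, almost everywhere in time -/

/-- Testing a bounded sequence for weak convergence against a total set suffices. -/
theorem tendsto_inner_zero_of_mem_closure_span {E : Type*} [NormedAddCommGroup E]
    [InnerProductSpace ℝ E] {x : ℕ → E} {C : ℝ} (hx : ∀ k, ‖x k‖ ≤ C) {D : Set E}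
    (hD : ∀ g ∈ D, Tendsto (fun k => inner ℝ g (x k)) atTop (𝓝 0)) {g : E}
    (hg : g ∈ (Submodule.span ℝ D).topologicalClosure) :
    Tendsto (fun k => inner ℝ g (x k)) atTop (𝓝 0) := by
  have hC : 0 ≤ C := (norm_nonneg _).trans (hx 0)
  have hspan : ∀ g ∈ Submodule.span ℝ D, Tendsto (fun k => inner ℝ g (x k)) atTop (𝓝 0) := by
    intro g hg
    induction hg using Submodule.span_induction with
    | mem g hg => exact hD g hg
    | zero => simp
    | add g g' _ _ h h' => simpa [inner_add_left] using h.add h'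
    | smul c g _ h => simpa [inner_smul_left] using h.const_mul c
  rw [Metric.tendsto_nhds]
  intro ε hε
  have hg' : g ∈ closure (Submodule.span ℝ D : Set E) := hg
  -- `C + 1` replaces `C` only to avoid division by zero.
  obtain ⟨g', hg's, hgg'⟩ := Metric.mem_closure_iff.1 hg' (ε / (2 * (C + 1))) (by positivity)
  filter_upwards [Metric.tendsto_nhds.1 (hspan g' hg's) (ε / 2) (half_pos hε)] with k hk
  rw [dist_zero_right] at hk ⊢
  have e : inner ℝ g (x k) = inner ℝ (g - g') (x k) + inner ℝ g' (x k) := by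
    rw [inner_sub_left]; ring
  have h1 : ‖inner ℝ (g - g') (x k)‖ ≤ ε / (2 * (C + 1)) * (C + 1) := by
    refine (norm_inner_le_norm _ _).trans ?_
    rw [dist_eq_norm] at hgg'
    exact mul_le_mul hgg'.le ((hx k).trans (by linarith)) (norm_nonneg _) (by positivity)
  have h2 : ε / (2 * (C + 1)) * (C + 1) = ε / 2 := by field_simp
  rw [e]
  linarith [norm_add_le (inner ℝ (g - g') (x k)) (inner ℝ g' (x k))]

/-- If the pairings of a bounded sequence with each element of `D` tend to zero in `L¹`, then along
a subsequence those with each element of the closed span of `D` tend to zero almost everywhere. -/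
theorem exists_subseq_ae_tendsto_inner_zero {α E : Type*} [MeasurableSpace α]
    [NormedAddCommGroup E] [InnerProductSpace ℝ E] [SecondCountableTopology E]
    {μ : Measure α} {v : ℕ → α → E} (hv : ∀ n, AEStronglyMeasurable (v n) μ) {C : ℝ}
    (hC : ∀ n, ∀ᵐ t ∂μ, ‖v n t‖ ≤ C) {S : ℕ → Set α} (hS : ∀ n, MeasurableSet (S n))
    (hSev : ∀ᵐ t ∂μ, ∀ᶠ n in atTop, t ∈ S n) {D : Set E} (hDne : D.Nonempty)
    (hD : ∀ g ∈ D, Tendsto (fun n => ∫⁻ t in S n, ‖inner ℝ g (v n t)‖ₑ ∂μ) atTop (𝓝 0)) :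
    ∃ σ : ℕ → ℕ, StrictMono σ ∧ ∀ᵐ t ∂μ, ∀ g ∈ (Submodule.span ℝ D).topologicalClosure,
      Tendsto (fun k => inner ℝ g (v (σ k) t)) atTop (𝓝 0) := by
  obtain ⟨D', hD'D, hD'c, hDD'⟩ :=
    (TopologicalSpace.IsSeparable.of_separableSpace D).exists_countable_dense_subset
  have hD'ne : D'.Nonempty := closure_nonempty_iff.1 (hDne.mono hDD')
  obtain ⟨e, rfl⟩ := hD'c.exists_eq_range hD'ne
  have heD : ∀ j, e j ∈ D := fun j => hD'D (mem_range_self j)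
  let f : ℕ → ℕ → α → ℝ≥0∞ := fun j n => (S n).indicator fun t => ‖inner ℝ (e j) (v n t)‖ₑ
  have hf : ∀ j n, AEMeasurable (f j n) μ := fun j n =>
    (aestronglyMeasurable_const.inner (hv n)).enorm.indicator (hS n)
  have hf0 : ∀ j, Tendsto (fun n => ∫⁻ t, f j n t ∂μ) atTop (𝓝 0) := fun j => by
    simp only [f, lintegral_indicator (hS _)]
    exact hD _ (heD j)
  -- Diagonal choice: at stage `k` the functionals `e 0, …, e k` all have integral below `2⁻¹ ^ k`.
  obtain ⟨σ, hσ, hσf⟩ := extraction_forall_of_eventually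
    (P := fun k n => ∀ j ∈ Finset.range (k + 1), ∫⁻ t, f j n t ∂μ < (2⁻¹ : ℝ≥0∞) ^ k)
    fun k => (Filter.eventually_all_finset _).2 fun j _ =>
      (hf0 j).eventually_lt_const (ENNReal.pow_pos (by simp) k)
  refine ⟨σ, hσ, ?_⟩
  have hsum : ∀ j, ∀ᵐ t ∂μ, Tendsto (fun k => f j (σ k) t) atTop (𝓝 0) := by
    intro j
    -- The index starts at `j`, the first stage that controls `e j`. A finite integral of the series
    -- forces its terms to zero almost everywhere.
    have h1 : ∫⁻ t, ∑' k, f j (σ (k + j)) t ∂μ ≠ ⊤ := by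
      rw [lintegral_tsum fun k => hf j _]
      have h2 : ∑' k, ∫⁻ t, f j (σ (k + j)) t ∂μ ≤ ∑' k, (2⁻¹ : ℝ≥0∞) ^ k := by
        refine ENNReal.tsum_le_tsum fun k => ?_
        refine (hσf (k + j) j (by simp)).le.trans ?_
        exact pow_le_pow_of_le_one zero_le (by simp) (by simp)
      refine ne_top_of_le_ne_top ?_ h2
      rw [ENNReal.tsum_geometric, ENNReal.one_sub_inv_two, inv_inv]
      simp
    filter_upwards [ae_lt_top' (AEMeasurable.tsum fun k => hf j _) h1] with t ht
    have := ENNReal.tendsto_atTop_zero_of_tsum_ne_top ht.ne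
    exact (tendsto_add_atTop_iff_nat (f := fun k => f j (σ k) t) j).1 this
  filter_upwards [ae_all_iff.2 hsum, ae_all_iff.2 hC, hSev] with t ht1 ht2 ht3 g hg
  refine tendsto_inner_zero_of_mem_closure_span (fun k => ht2 (σ k)) (D := range e) ?_ ?_
  · rintro _ ⟨j, rfl⟩
    rw [tendsto_zero_iff_norm_tendsto_zero]
    have h1 : Tendsto (fun k => ‖inner ℝ (e j) (v (σ k) t)‖ₑ) atTop (𝓝 0) := by
      refine (ht1 j).congr' ?_
      filter_upwards [hσ.tendsto_atTop.eventually ht3] with k hk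
      exact indicator_of_mem hk _
    refine ((ENNReal.tendsto_toReal ENNReal.zero_ne_top).comp h1).congr fun k => ?_
    exact toReal_enorm _
  · have hle : Submodule.span ℝ D ≤ (Submodule.span ℝ (range e)).topologicalClosure :=
      Submodule.span_le.2 fun x hx =>
        closure_mono Submodule.subset_span (hDD' hx)
    exact Submodule.topologicalClosure_minimal _ hle
      (Submodule.isClosed_topologicalClosure _) hg

/-! ### Gradients span the orthogonal complement of H -/

/-- The functionals on `Y` given by gradients of `C¹` functions on `ℝ^d`, as elements of `Y`. -/
def gradientFields {d : ℕ} (Ω : Set (Euc d)) : Set (YSpace Ω) :=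
  {g | ∃ q : Euc d → ℝ, ContDiff ℝ 1 q ∧
    ∀ v : YSpace Ω, inner ℝ g v = ∫ x in Ω, fderiv ℝ q x (v x)}

theorem exists_gradientField {d : ℕ} {Ω : Set (Euc d)} (hΩ : IsOpen Ω)
    (hΩb : Bornology.IsBounded Ω) {q : Euc d → ℝ} (hq : ContDiff ℝ 1 q) :
    ∃ g : YSpace Ω, ∀ v : YSpace Ω, inner ℝ g v = ∫ x in Ω, fderiv ℝ q x (v x) := by
  have : IsFiniteMeasure (leb Ω) := ⟨by simpa using hΩb.measure_lt_top⟩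
  have hc : Continuous (fun x => (InnerProductSpace.toDual ℝ (Euc d)).symm (fderiv ℝ q x)) :=
    (InnerProductSpace.toDual ℝ (Euc d)).symm.continuous.comp (hq.continuous_fderiv one_ne_zero)
  obtain ⟨M, hM⟩ := exists_bound_of_isBounded hΩb hΩ.measurableSet hc
  have hmem : MemLp _ 2 (leb Ω) := MemLp.of_bound hc.aestronglyMeasurable M hM
  refine ⟨hmem.toLp _, fun v => ?_⟩
  rw [L2.inner_def]
  refine integral_congr_ae (hmem.coeFn_toLp.mono fun x hx => ?_)
  simp only [hx, InnerProductSpace.toDual_symm_apply]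

/-- Dual form of the membership criterion for H: the closed span is a double orthogonal complement,
and complements reverse inclusions. -/
theorem orthogonal_HSol_le_closure_span_gradientFields {d : ℕ} {Ω : Set (Euc d)}
    (hΩ : IsBoundedLipschitzDomain Ω) :
    (HSol Ω)ᗮ ≤ (Submodule.span ℝ (gradientFields Ω)).topologicalClosure := by
  rw [← Submodule.orthogonal_orthogonal_eq_closure]
  refine Submodule.orthogonal_le fun v hv => ?_
  refine mem_HSol_of_forall_integral_fderiv_eq_zero hΩ v fun q hq => ?_
  obtain ⟨g, hg⟩ := exists_gradientField hΩ.isOpen hΩ.isBounded hq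
  rw [← hg]
  exact hv g (Submodule.subset_span ⟨q, hq, hg⟩)

theorem tendsto_toWeakSpace_zero {E : Type*} [NormedAddCommGroup E] [InnerProductSpace ℝ E]
    [CompleteSpace E] {x : ℕ → E} (hx : ∀ g, Tendsto (fun k => inner ℝ g (x k)) atTop (𝓝 0)) :
    Tendsto (fun k => toWeakSpace ℝ E (x k)) atTop (𝓝 0) := by
  refine (WeakBilin.tendsto_iff_forall_eval_tendsto _ ?_).2 fun f => ?_
  · exact fun a b hab => ext_inner_left ℝ fun w => LinearMap.congr_fun hab (innerSL ℝ w)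
  · have h0 : (topDualPairing ℝ E).flip (0 : E) f = 0 := map_zero f
    change Tendsto (fun k => f (x k)) atTop (𝓝 ((topDualPairing ℝ E).flip (0 : E) f))
    rw [h0]
    refine (hx ((InnerProductSpace.toDual ℝ E).symm f)).congr fun k => ?_
    exact InnerProductSpace.toDual_symm_apply

/-! ### The main lemma -/

theorem lemma5 {d : ℕ} (hd : 2 ≤ d) (Ω : Set (Euc d)) (hΩ : IsBoundedLipschitzDomain Ω)
    (T : ℝ) (hT : 0 < T)
    -- the triangulations, indexed by their mesh-sizes
    (H : Set ℝ) (hH : ∀ h ∈ H, 0 < h)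
    (𝒯 : ℝ → Geometry.SimplicialComplex ℝ (Euc d)) (h𝒯 : IsShapeRegularFamily Ω H 𝒯)
    -- the finite element spaces
    (m l : ℕ) (V : ℝ → Submodule ℝ (YSpace Ω))
    (hV : ∀ h ∈ H, ∀ z ∈ V h, ∀ i : Fin d, IsContPiecewisePoly Ω (𝒯 h) m (fun x => z x i))
    (Q : ℝ → Submodule ℝ (Lp ℝ 1 (leb Ω)))
    (hQ : ∀ h ∈ H, ∀ q ∈ Q h, IsPiecewisePoly Ω (𝒯 h) l q)
    (hQapprox : IsPressureFamily Ω H Q)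
    -- the sequences
    (h : ℕ → ℝ) (hhH : ∀ n, h n ∈ H) (hh0 : Tendsto h atTop (𝓝 0))
    (r : ℝ≥0∞) (hr1 : 1 < r) (hr : r < ⊤)
    (τ : ℕ → ℝ) (hτ : ∀ n, τ n ∈ Ioo 0 T) (hτ0 : Tendsto τ atTop (𝓝 0))
    (v : ℕ → ℝ → YSpace Ω)
    (hv : ∀ n, MemLp (v n) ⊤ (volume.restrict (Ioo 0 T)))
    (hvV : ∀ n, ∀ᵐ t ∂(volume.restrict (Ioo 0 T)), v n t ∈ discDivFree Ω (V (h n)) (Q (h n)))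
    (hbdd : ∃ C : ℝ≥0, ∀ n, eLpNorm (v n) ⊤ (volume.restrict (Ioo 0 T)) +
      (∫⁻ t in Ioo (τ n) T, eLpNorm (weakDiv Ω (v n t)) r (leb Ω)) ≤ C) :
    ∃ σ : ℕ → ℕ, StrictMono σ ∧
      ∃ J : Set ℝ, J ⊆ Ioo 0 T ∧ MeasurableSet J ∧ volume (Ioo 0 T \ J) = 0 ∧
        ∀ t ∈ J, Tendsto
          (fun k => toWeakSpace ℝ (HSol Ω)ᗮ ((HSol Ω)ᗮ.orthogonalProjectionOnto (v (σ k) t)))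
          atTop (𝓝 0) := by
  obtain ⟨C, hC⟩ := hbdd
  set μ : Measure ℝ := volume.restrict (Ioo 0 T) with hμ
  have hopen := hΩ.isOpen
  have hbd := hΩ.isBounded
  have hm := hopen.measurableSet
  have hnorm : ∀ n, ∀ᵐ t ∂μ, ‖v n t‖ ≤ C := fun n => by
    have h1 : eLpNormEssSup (v n) μ ≤ C := by
      rw [← eLpNorm_exponent_top]; exact le_self_add.trans (hC n)
    filter_upwards [ae_le_eLpNormEssSup (f := v n) (μ := μ)] with t ht
    have h2 : (‖v n t‖₊ : ℝ≥0∞) ≤ C := ht.trans h1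
    exact_mod_cast h2
  have hμS : ∀ n, μ.restrict (Ioo (τ n) T) = volume.restrict (Ioo (τ n) T) := fun n => by
    rw [hμ, Measure.restrict_restrict measurableSet_Ioo,
      inter_eq_left.2 (Ioo_subset_Ioo_left (hτ n).1.le)]
  have hSev : ∀ᵐ t ∂μ, ∀ᶠ n in atTop, t ∈ Ioo (τ n) T := by
    filter_upwards [ae_restrict_mem measurableSet_Ioo] with t ht
    filter_upwards [hτ0.eventually_lt_const ht.1] with n hn using ⟨hn, ht.2⟩
  have hzero : (0 : YSpace Ω) ∈ gradientFields Ω :=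
    ⟨fun _ => 0, contDiff_const, fun w => by simp⟩
  set s := ENNReal.conjExponent r with hs
  have : ENNReal.HolderConjugate r s := ENNReal.HolderConjugate.conjExponent hr1.le
  have hs1 : 1 ≤ s := le_self_add
  have hslt : s < ⊤ := by
    rw [hs, ENNReal.conjExponent]
    simpa using hr1
  have hgrad : ∀ g ∈ gradientFields Ω,
      Tendsto (fun n => ∫⁻ t in Ioo (τ n) T, ‖inner ℝ g (v n t)‖ₑ ∂μ) atTop (𝓝 0) := by
    rintro g ⟨q, hq, hg⟩
    have hfin : IsFiniteMeasure (leb Ω) := ⟨by simpa using hbd.measure_lt_top⟩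
    obtain ⟨M, hM⟩ := exists_bound_of_isBounded hbd hm hq.continuous
    have hqs : MemLp q s (leb Ω) := MemLp.of_bound hq.continuous.aestronglyMeasurable M hM
    have hlim := (hQapprox.approx s hs1 hslt q hqs).comp
      (tendsto_nhdsWithin_iff.2 ⟨hh0, Eventually.of_forall hhH⟩)
    -- Here `δ` is the pressure approximation error of `q` in L^s, and `C` bounds the time integral
    -- of the divergence norm.
    have hstep : ∀ δ : ℝ≥0, 0 < δ → ∀ᶠ n in atTop,
        ∫⁻ t in Ioo (τ n) T, ‖inner ℝ g (v n t)‖ₑ ∂μ ≤ C * δ := by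
      intro δ hδ
      filter_upwards [hlim.eventually_lt_const (ENNReal.coe_pos.2 hδ)] with n hn
      simp only [Function.comp_apply, iInf_lt_iff] at hn
      obtain ⟨qh, hqh, hlt⟩ := hn
      obtain ⟨B, hB⟩ := (hQ _ (hhH n) qh hqh).exists_ae_bound hm
        (h𝒯.triangulation _ (hhH n))
      calc ∫⁻ t in Ioo (τ n) T, ‖inner ℝ g (v n t)‖ₑ ∂μ
          ≤ ∫⁻ t in Ioo (τ n) T, eLpNorm (weakDiv Ω (v n t)) r (leb Ω) * δ ∂μ := by
            refine lintegral_mono_ae (ae_restrict_of_ae ?_)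
            filter_upwards [hvV n] with t ht
            rw [hg]
            refine (enorm_integral_fderiv_le_of_mem_discDivFree hopen hbd ht hq hqh hB
              (r := r) (s := s)).trans ?_
            gcongr
        _ = (∫⁻ t in Ioo (τ n) T, eLpNorm (weakDiv Ω (v n t)) r (leb Ω)) * δ := by
            -- As `δ` is finite, no measurability in time of the divergence norm is required.
            rw [lintegral_mul_const' _ _ ENNReal.coe_ne_top, hμS]
        _ ≤ C * δ := by
            gcongr
            exact le_add_self.trans (hC n)
    rw [ENNReal.tendsto_nhds_zero]
    intro ε hε
    obtain ⟨δ, hδ0, hδ⟩ := ENNReal.exists_nnreal_pos_mul_lt (a := C) ENNReal.coe_ne_top hε.ne'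
    filter_upwards [hstep δ hδ0] with n hn
    rw [mul_comm] at hn
    exact hn.trans hδ.le
  have : Fact ((2 : ℝ≥0∞) ≠ ⊤) := ⟨by simp⟩
  obtain ⟨σ, hσ, hae⟩ := exists_subseq_ae_tendsto_inner_zero (fun n => (hv n).1) hnorm
    (fun n => measurableSet_Ioo) hSev ⟨0, hzero⟩ hgrad
  refine ⟨σ, hσ, ?_⟩
  obtain ⟨N, hNsub, hNm, hN0⟩ := exists_measurable_superset_of_null hae
  refine ⟨Ioo 0 T \ N, sdiff_subset, measurableSet_Ioo.diff hNm, ?_, fun t ht => ?_⟩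
  · rw [Set.sdiff_sdiff_right_self]
    rwa [hμ, Measure.restrict_apply hNm, inter_comm] at hN0
  · have htg : ∀ g ∈ (Submodule.span ℝ (gradientFields Ω)).topologicalClosure,
        Tendsto (fun k => inner ℝ g (v (σ k) t)) atTop (𝓝 0) := by
      by_contra hcon
      exact ht.2 (hNsub hcon)
    refine tendsto_toWeakSpace_zero fun g => ?_
    -- For `g` in H^⊥ the projection does not change the pairing with `v (σ k) t`.
    refine (htg g (orthogonal_HSol_le_closure_span_gradientFields hΩ g.2)).congr fun k => ?_
    exact (Submodule.inner_orthogonalProjectionOnto_eq_of_mem_left g _).symm
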